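/- Work in $[0,1]$-valued continuous first-order logic, in the signature $L^{pr}$ with constants $0,1$, a unary operation $\cdot^{c}$, binary operations $\cap,\cup$, a unary predicate $\mu$, and the metric $d$ (moduli of uniform continuity: $\Delta(\varepsilon)=\varepsilon$ for $\cdot^{c}$ and $\mu$, and $\Delta(\varepsilon)=\varepsilon/2$ for $\cap$ and $\cup$). All continuous functions $[0,1]^k\to[0,1]$ are connectives, and $\sup,\inf$ are the quantifiers. An $L^{pr}$-structure is a complete metric space of diameter at most $1$ with interpretations of the symbols that respect these moduli. A theory is a set of conditions $\sigma=0$ with $\sigma$ a sentence; a condition $\sigma=r$ stands for $|\sigma-r|=0$. Write $\mathcal M\equiv\mathcal N$ (elementarily equivalent) if $\sigma^{\mathcal M}=\sigma^{\mathcal N}$ for every sentence $\sigma$. Let $\dot-$ and $\dot+$ denote subtraction and addition truncated to $[0,1]$. Let $Pr$ be the theory of probability algebras: the equational axioms of Boolean algebras, $\mu(0)=0$, $\mu(1)=1$, $\sup_x\sup_y(\mu(x\cap y)\mathbin{\dot-}\mu(x))=0$, $\sup_x\sup_y(\mu(x)\mathbin{\dot-}\mu(x\cup y))=0$, $\sup_x\sup_y|(\mu(x)\mathbin{\dot-}\mu(x\cap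 y))-(\mu(x\cup y)\mathbin{\dot-}\mu(y))|=0$ and $\sup_x\sup_y|d(x,y)-\mu(x\triangle y)|=0$. For $\mathcal M\models Pr$, an atom is an element $a$ with $\mu(a)>0$ such that every $b\subseteq a$ has $\mu(b)=0$ or $\mu(a\setminus b)=0$. Let $\Phi^{\mathcal M}$ be the sequence that lists the measures of the distinct atoms of $\mathcal M$ in decreasing order, followed by zeros if there are only finitely many atoms. Define formulas $$\chi(x)=\inf_y|\mu(x\cap y)-\mu(x\cap y^c)|,\qquad \psi(x)=\mu(x)\mathbin{\dot-}\chi(x),\qquad \varphi_1(x)=\inf_z\bigl(d(x,z)\mathbin{\dot+}\psi(z)\bigr),$$ $$\varphi_n(x)=\inf_w\bigl(\varphi_{n-1}(x\cap w)\mathbin{\dot+}\varphi_1(x\cap w^c)\bigr)\qquad(n>1).$$ **Corollary 4.12.** For models $\mathcal M,\mathcal N$ of $Pr$, we have $\mathcal M\equiv\mathcal N$ if and only if $\Phi^{\mathcal M}=\Phi^{\mathcal N}$. Moreover, if $T$ is any complete extension of $Pr$ in the signature $L^{pr}$ (that is, $T$ is satisfiable, any two models of $T$ are elementarily equivalent,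 and every model of $T$ is a model of $Pr$), then all models $\mathcal M$ of $T$ have the same sequence $\Phi^{\mathcal M}=(t_n\mid n\ge1)$, and $T$ is axiomatized by (has the same models as) the theory obtained by adding to $Pr$ the conditions $\varphi_1(1)=1-t_1$ and $\varphi_{n-1}(1)\mathbin{\dot-}\varphi_n(1)=t_n$ for all $n>1$. -/

import Mathlib

/-! Continuous (`[0,1]`-valued) first-order logic for the signature of probability algebras:
constants `0`, `1`, a unary operation (complement), binary operations `∩`, `∪`, a unary
predicate `μ`, and the metric `d`. -/

universe u v

namespace ProbAlg

/-- A metric structure for the signature of probability algebras: a complete metric space of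
diameter at most `1`, with interpretations of the symbols that obey the moduli of uniform
continuity of the signature, namely `Δ(ε) = ε` for the complement and for `μ`, and
`Δ(ε) = ε / 2` for `∩` and `∪` (with respect to the maximum metric on pairs).
No axiom about Boolean algebras or measures is imposed here. -/
class LprStructure (M : Type u) extends MetricSpace M, CompleteSpace M where
  dist_le_one : ∀ x y : M, dist x y ≤ 1
  zero : M
  one : M
  compl : M → M
  inter : M → M → M
  union : M → M → M
  mu : M → unitInterval
  compl_modulus : ∀ ε : ℝ, 0 < ε → ∀ x y : M, dist x y < ε → dist (compl x) (compl y) ≤ ε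
  inter_modulus : ∀ ε : ℝ, 0 < ε → ∀ x y x' y' : M,
    dist x x' < ε / 2 → dist y y' < ε / 2 → dist (inter x y) (inter x' y') ≤ ε
  union_modulus : ∀ ε : ℝ, 0 < ε → ∀ x y x' y' : M,
    dist x x' < ε / 2 → dist y y' < ε / 2 → dist (union x y) (union x' y') ≤ ε
  mu_modulus : ∀ ε : ℝ, 0 < ε → ∀ x y : M, dist x y < ε → |(mu x : ℝ) - mu y| ≤ ε

/-- Terms in the variables `x₀, …, xₙ₋₁`. -/
inductive Term (n : ℕ) : Type
  | var (i : Fin n) : Term n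
  | zero : Term n
  | one : Term n
  | compl (t : Term n) : Term n
  | inter (s t : Term n) : Term n
  | union (s t : Term n) : Term n

/-- Formulas with free variables among `x₀, …, xₙ₋₁`.  Every continuous function
`[0,1]^k → [0,1]` is a connective, and `sup`, `inf` are the quantifiers; they bind the
last variable. -/
inductive Formula : ℕ → Type
  | mu {n : ℕ} (t : Term n) : Formula n
  | dist {n : ℕ} (s t : Term n) : Formula n
  | conn {n k : ℕ} (c : C(Fin k → unitInterval, unitInterval))
      (φ : Fin k → Formula n) : Formula n
  | sup {n : ℕ} (φ : Formula (n + 1)) : Formula n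
  | inf {n : ℕ} (φ : Formula (n + 1)) : Formula n

abbrev Sentence : Type := Formula 0

/-- A set of closed conditions; the sentence `σ` stands for the condition `σ = 0`. -/
abbrev Theory : Type := Set Sentence

section Semantics

variable (M : Type u) [LprStructure M]

def Term.eval {n : ℕ} : Term n → (Fin n → M) → M
  | .var i, a => a i
  | .zero, _ => LprStructure.zero
  | .one, _ => LprStructure.one
  | .compl t, a => LprStructure.compl (t.eval a)
  | .inter s t, a => LprStructure.inter (s.eval a) (t.eval a)
  | .union s t, a => LprStructure.union (s.eval a) (t.eval a)

/-- The value `φ^M(a)` in `[0,1]`; suprema and infima are taken in the complete lattice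
`[0,1]`, over the (non-empty) universe `M`. -/
noncomputable def Formula.eval : {n : ℕ} → Formula n → (Fin n → M) → unitInterval
  | _, .mu t, a => LprStructure.mu (t.eval M a)
  | _, .dist s t, a =>
      ⟨Dist.dist (s.eval M a) (t.eval M a), dist_nonneg, LprStructure.dist_le_one _ _⟩
  | _, .conn c φ, a => c (fun i => (φ i).eval a)
  | _, .sup φ, a => ⨆ x : M, φ.eval (Fin.snoc (α := fun _ => M) a x)
  | _, .inf φ, a => ⨅ x : M, φ.eval (Fin.snoc (α := fun _ => M) a x)

noncomputable def Sentence.value (σ : Sentence) : unitInterval :=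
  Formula.eval M σ Fin.elim0

/-- `M ⊨ T`: all the conditions `σ = 0`, for `σ ∈ T`, hold in `M`. -/
def Models (T : Theory) : Prop := ∀ σ ∈ T, Sentence.value M σ = 0

/-- `M ≡ N`: every sentence has the same value in `M` and in `N`. -/
def ElemEquiv (N : Type v) [LprStructure N] : Prop :=
  ∀ σ : Sentence, Sentence.value M σ = Sentence.value N σ

end Semantics

/-- `T` is complete: it is satisfiable and all its models are elementarily equivalent. -/
def Theory.IsComplete (T : Theory) : Prop :=
  (∃ (M : Type u) (_ : LprStructure M), Models M T) ∧
    ∀ (M N : Type u) [LprStructure M] [LprStructure N],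
      Models M T → Models N T → ElemEquiv M N

/-- `T` is an extension of `T₀`: every condition in `T₀` is a consequence of `T`. -/
def Theory.Extends (T T₀ : Theory) : Prop :=
  ∀ (M : Type u) [LprStructure M], Models M T → Models M T₀

/-- `T` is axiomatized by `S`: the two sets of conditions have the same models. -/
def Theory.IsAxiomatizedBy (T S : Theory) : Prop :=
  ∀ (M : Type u) [LprStructure M], Models M T ↔ Models M S

/-! Some connectives.  `Set.projIcc 0 1` truncates a real number to `[0,1]`. -/

/-- `(x, y) ↦ max (x - y) 0`. -/
noncomputable def subConn : C(Fin 2 → unitInterval, unitInterval) where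
  toFun v := Set.projIcc 0 1 zero_le_one ((v 0 : ℝ) - v 1)
  continuous_toFun := continuous_projIcc.comp (by fun_prop)

/-- `(x, y) ↦ min (x + y) 1`. -/
noncomputable def addConn : C(Fin 2 → unitInterval, unitInterval) where
  toFun v := Set.projIcc 0 1 zero_le_one ((v 0 : ℝ) + v 1)
  continuous_toFun := continuous_projIcc.comp (by fun_prop)

/-- `(x, y) ↦ |x - y|`. -/
noncomputable def absDiffConn : C(Fin 2 → unitInterval, unitInterval) where
  toFun v := Set.projIcc 0 1 zero_le_one |(v 0 : ℝ) - v 1|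
  continuous_toFun := continuous_projIcc.comp (by fun_prop)

noncomputable def Formula.sub {n : ℕ} (φ ψ : Formula n) : Formula n := .conn subConn ![φ, ψ]

noncomputable def Formula.add {n : ℕ} (φ ψ : Formula n) : Formula n := .conn addConn ![φ, ψ]

noncomputable def Formula.absDiff {n : ℕ} (φ ψ : Formula n) : Formula n :=
  .conn absDiffConn ![φ, ψ]

/-- The constant `r`, as a connective without arguments. -/
def Formula.const {n : ℕ} (r : unitInterval) : Formula n :=
  .conn (k := 0) (ContinuousMap.const _ r) Fin.elim0

/-- The condition `φ = r`, that is, `|φ - r| = 0`. -/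
noncomputable def Formula.eqConst {n : ℕ} (φ : Formula n) (r : unitInterval) : Formula n :=
  φ.absDiff (.const r)

/-! The axioms `Pr`. -/

/-- The symmetric difference `(s ∩ tᶜ) ∪ (sᶜ ∩ t)`. -/
def Term.symmDiff {n : ℕ} (s t : Term n) : Term n :=
  .union (.inter s (.compl t)) (.inter (.compl s) t)

def x1 : Term 1 := .var 0
def x2 : Term 2 := .var 0
def y2 : Term 2 := .var 1
def x3 : Term 3 := .var 0
def y3 : Term 3 := .var 1
def z3 : Term 3 := .var 2

/-- The equational axioms of Boolean algebras, each as the condition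
`sup … sup d(s, t) = 0`. -/
def booleanAxioms : Theory :=
  { .sup (.sup (.dist (.union x2 y2) (.union y2 x2))),
    .sup (.sup (.dist (.inter x2 y2) (.inter y2 x2))),
    .sup (.sup (.sup (.dist (.union x3 (.union y3 z3)) (.union (.union x3 y3) z3)))),
    .sup (.sup (.sup (.dist (.inter x3 (.inter y3 z3)) (.inter (.inter x3 y3) z3)))),
    .sup (.sup (.dist (.union x2 (.inter x2 y2)) x2)),
    .sup (.sup (.dist (.inter x2 (.union x2 y2)) x2)),
    .sup (.sup (.sup (.dist (.inter x3 (.union y3 z3))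
      (.union (.inter x3 y3) (.inter x3 z3))))),
    .sup (.sup (.sup (.dist (.union x3 (.inter y3 z3))
      (.inter (.union x3 y3) (.union x3 z3))))),
    .sup (.dist (.union x1 .zero) x1),
    .sup (.dist (.inter x1 .one) x1),
    .sup (.dist (.union x1 (.compl x1)) .one),
    .sup (.dist (.inter x1 (.compl x1)) .zero) }

noncomputable def measureAxioms : Theory :=
  { .mu .zero,
    Formula.eqConst (.mu .one) 1,
    .sup (.sup (Formula.sub (.mu (.inter x2 y2)) (.mu x2))),
    .sup (.sup (Formula.sub (.mu x2) (.mu (.union x2 y2)))),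
    .sup (.sup (Formula.absDiff
      (Formula.sub (.mu x2) (.mu (.inter x2 y2)))
      (Formula.sub (.mu (.union x2 y2)) (.mu y2)))) }

noncomputable def metricAxiom : Sentence :=
  .sup (.sup (Formula.absDiff (.dist x2 y2) (.mu (x2.symmDiff y2))))

/-- The theory of probability algebras. -/
noncomputable def Pr : Theory := booleanAxioms ∪ measureAxioms ∪ {metricAxiom}

/-! Atoms and their sizes. -/

section Atoms

variable {M : Type u} [LprStructure M]

/-- `x ⊆ a`, that is, `x ∩ a = x`. -/
def IsContained (x a : M) : Prop := LprStructure.inter x a = x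

/-- `a` has positive measure, and every `b ⊆ a` satisfies `μ(b) = 0` or `μ(a ∖ b) = 0`. -/
def IsAtomEvent (a : M) : Prop :=
  0 < LprStructure.mu a ∧ ∀ b : M, IsContained b a →
    LprStructure.mu b = 0 ∨ LprStructure.mu (LprStructure.inter a (LprStructure.compl b)) = 0

/-- The `(n+1)`-st largest measure of an atom contained in `a` (atoms are counted with
multiplicity): the largest `r` such that there are `n + 1` distinct atoms contained in `a` of
measure at least `r`, and `0` if there are not so many atoms in `a`
(the supremum in `[0,1]` of the empty set is `0`). -/
noncomputable def atomSize (a : M) (n : ℕ) : unitInterval :=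
  sSup {r | ∃ s : Finset M, s.card = n + 1 ∧
    ∀ x ∈ s, IsAtomEvent x ∧ IsContained x a ∧ r ≤ LprStructure.mu x}

variable (M)

/-- The sequence `Φ^M` of the sizes of the atoms of `M`, in decreasing order, followed by zeros
if there are finitely many atoms.  The index `n : ℕ` corresponds to the `(n+1)`-st term. -/
noncomputable def Phi : ℕ → unitInterval := atomSize (LprStructure.one : M)

end Atoms

/-! The formulas `χ, ψ, φ₁, φ₂, …` in one free variable, with a term substituted for it. -/

/-- The term `t`, regarded as a term in one more variable. -/
def Term.lift {n : ℕ} : Term n → Term (n + 1)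
  | .var i => .var i.castSucc
  | .zero => .zero
  | .one => .one
  | .compl t => .compl t.lift
  | .inter s t => .inter s.lift t.lift
  | .union s t => .union s.lift t.lift

/-- The last variable, the one that a quantifier binds. -/
def Term.last {n : ℕ} : Term (n + 1) := .var (Fin.last n)

/-- `χ(t) = inf_y |μ(t ∩ y) - μ(t ∩ yᶜ)|`. -/
noncomputable def chi {n : ℕ} (t : Term n) : Formula n :=
  .inf (Formula.absDiff (.mu (.inter t.lift .last)) (.mu (.inter t.lift (.compl .last))))

/-- `ψ(t) = μ(t) ∸ χ(t)`, where `∸` is truncated subtraction. -/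
noncomputable def psi {n : ℕ} (t : Term n) : Formula n := Formula.sub (.mu t) (chi t)

/-- `phi m t` is `φₘ₊₁(t)`, where `φ₁(t) = inf_z (d(t, z) ∔ ψ(z))` and
`φₙ(t) = inf_w (φₙ₋₁(t ∩ w) ∔ φ₁(t ∩ wᶜ))` for `n > 1`, with truncated addition `∔`. -/
noncomputable def phi : ℕ → {n : ℕ} → Term n → Formula n
  | 0, _, t => .inf (Formula.add (.dist t.lift .last) (psi .last))
  | m + 1, _, t => .inf (Formula.add (phi m (.inter t.lift .last))
      (phi 0 (.inter t.lift (.compl .last))))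

/-- The conditions `φ₁(1) = 1 - t₁` and `φₙ₋₁(1) ∸ φₙ(1) = tₙ` for `n > 1`;
the sequence `t₁, t₂, …` is given as `t 0, t 1, …`, and `unitInterval.symm r = 1 - r`. -/
noncomputable def atomSizeAxioms (t : ℕ → unitInterval) : Theory :=
  insert (Formula.eqConst (phi 0 .one) (unitInterval.symm (t 0)))
    (Set.range fun m : ℕ =>
      Formula.eqConst (Formula.sub (phi m .one) (phi (m + 1) .one)) (t (m + 1)))

end ProbAlg

/-! A model of `Pr` is a Boolean algebra with a strictly positive finitely additive probability;
metric completeness makes increasing sequences converge (`exists_limit_of_monotone`), which yields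
suprema and, in atomless elements, parts of every intermediate measure. Sentences determine `Phi`:
by `eval_phi`, the formula φₖ takes at x the value m x minus `topMass k x`, the supremal mass of at
most k atoms below x. For k = 1 this holds because x can be halved up to an error at most its
largest atom (`exists_balanced`), while an atom cannot be split at all, so that ψ vanishes on atoms.
Larger k follow by cutting off one atom at a time. Hence φₖ(1) = 1 - (t₁ + … + tₖ), and successive
differences recover the sequence. Conversely, equal sequences give a measure-preserving bijection π
of the atoms. An exact back-and-forth between finite partitions, whose corresponding pieces have
equal measure and contain the same atoms up to π, shows that all formulas agree
(`BackForth.eval_eq`). One step transports atoms along π and adds an atomless part of the right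
measure (`Matched.exists_le`); it works in arbitrary models, without saturation. The axiomatization
follows: `atomSizeAxioms t` says exactly that the sequence is t. -/

open Filter Topology

namespace ProbAlg

/-- A Boolean algebra with a strictly positive finitely additive probability, in which every
increasing sequence is bounded above by an element whose measure is the limit of the measures. -/
class ProbabilityAlgebra (A : Type*) extends BooleanAlgebra A where
  m : A → ℝ
  m_bot : m ⊥ = 0
  m_top : m ⊤ = 1
  m_sup : ∀ x y : A, Disjoint x y → m (x ⊔ y) = m x + m y
  m_pos : ∀ x : A, x ≠ ⊥ → 0 < m x
  exists_limit : ∀ w : ℕ → A, Monotone w →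
    ∃ x, (∀ n, w n ≤ x) ∧ Tendsto (fun n => m (w n)) atTop (𝓝 (m x))

/-! ### Finite additivity and its elementary consequences. -/

namespace ProbabilityAlgebra

variable {A : Type*} [ProbabilityAlgebra A]

lemma m_nonneg (x : A) : 0 ≤ m x := by
  by_cases h : x = ⊥
  · rw [h, m_bot]
  · exact (m_pos x h).le

lemma m_eq_zero {x : A} (h : m x = 0) : x = ⊥ := by
  by_contra h'
  exact (m_pos x h').ne' h

lemma m_inf_add_sdiff (x y : A) : m (x ⊓ y) + m (x \ y) = m x := by
  rw [← m_sup _ _ disjoint_inf_sdiff, sup_inf_sdiff]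

lemma m_inf_add_inf_compl (x y : A) : m (x ⊓ y) + m (x ⊓ yᶜ) = m x := by
  rw [← sdiff_eq, m_inf_add_sdiff]

lemma m_sdiff {x y : A} (h : y ≤ x) : m (x \ y) = m x - m y := by
  have := m_inf_add_sdiff x y
  rw [inf_eq_right.2 h] at this
  linarith

lemma m_mono {x y : A} (h : x ≤ y) : m x ≤ m y := by
  have := m_sdiff h
  have := m_nonneg (y \ x)
  linarith

lemma m_le_one (x : A) : m x ≤ 1 := m_top (A := A) ▸ m_mono le_top

lemma eq_of_le_of_m_le {x y : A} (h : x ≤ y) (h' : m y ≤ m x) : x = y := by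
  have h1 := m_sdiff h
  have h2 := m_nonneg (y \ x)
  have : y \ x = ⊥ := m_eq_zero (by linarith)
  exact le_antisymm h (sdiff_eq_bot_iff.1 this)

lemma m_sup_le (x y : A) : m (x ⊔ y) ≤ m x + m y := by
  rw [← sup_sdiff_self_right, m_sup _ _ disjoint_sdiff_self_right]
  have := m_mono (sdiff_le : y \ x ≤ y)
  linarith

lemma m_finset_sup {ι : Type*} (s : Finset ι) (f : ι → A)
    (h : (s : Set ι).PairwiseDisjoint f) : m (s.sup f) = ∑ i ∈ s, m (f i) := by
  classical
  induction s using Finset.induction_on with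
  | empty => simp [m_bot]
  | insert i s hi ih =>
    rw [Finset.sup_insert, Finset.sum_insert hi, m_sup, ih]
    · exact h.subset (by simp)
    · refine Finset.disjoint_sup_right.2 fun j hj => h (by simp) (by simp [hj]) ?_
      rintro rfl
      exact hi hj

/-! Increasing sequences and maximal elements. -/

/-- `P` contains the limits of its increasing sequences. -/
def IsClosedSeq (P : Set A) : Prop :=
  ∀ (w : ℕ → A) (x : A), Monotone w → (∀ n, w n ∈ P) → (∀ n, w n ≤ x) →
    Tendsto (fun n => m (w n)) atTop (𝓝 (m x)) → x ∈ P

lemma le_of_limit_le {w : ℕ → A} {x y : A} (hw : ∀ n, w n ≤ x)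
    (hx : Tendsto (fun n => m (w n)) atTop (𝓝 (m x))) (hy : ∀ n, w n ≤ y) : x ≤ y := by
  have : m x ≤ m (x ⊓ y) := le_of_tendsto' hx fun n => m_mono (le_inf (hw n) (hy n))
  exact inf_eq_left.1 (eq_of_le_of_m_le inf_le_left this)

lemma exists_monotone_tendsto {C : Set A} (hC : IsChain (· ≤ ·) C) (hne : C.Nonempty) :
    ∃ w : ℕ → A, Monotone w ∧ (∀ n, w n ∈ C) ∧
      Tendsto (fun n => m (w n)) atTop (𝓝 (sSup (m '' C))) := by
  have hb : BddAbove (m '' C) := ⟨1, by rintro _ ⟨x, -, rfl⟩; exact m_le_one x⟩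
  obtain ⟨f, hf, hft, hfC⟩ := exists_seq_tendsto_sSup (hne.image m) hb
  choose g hgC hg using hfC
  have key : ∀ x : C, ∀ y : C, ∃ z : C, (x : A) ≤ z ∧ (y : A) ≤ z := by
    intro x y
    rcases hC.total x.2 y.2 with h | h
    · exact ⟨y, h, le_rfl⟩
    · exact ⟨x, le_rfl, h⟩
  choose j hj1 hj2 using key
  let w : ℕ → C := fun n => Nat.rec ⟨g 0, hgC 0⟩ (fun k x => j x ⟨g (k + 1), hgC (k + 1)⟩) n
  refine ⟨Subtype.val ∘ w, monotone_nat_of_le_succ fun n => hj1 _ _, fun n => (w n).2, ?_⟩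
  refine tendsto_of_tendsto_of_tendsto_of_le_of_le hft tendsto_const_nhds (fun n => ?_)
    (fun n => le_csSup hb ⟨_, (w n).2, rfl⟩)
  rw [← hg]
  cases n with
  | zero => exact le_rfl
  | succ k => exact m_mono (hj2 (w k) ⟨g (k + 1), hgC (k + 1)⟩)

/-- Sequential closure suffices for Zorn: some sequence in a chain has measures tending to their
supremum over the chain. A chain element above the whole sequence lies above its limit and has no
larger measure, so by strict positivity it is the limit. -/
lemma exists_maximal {P : Set A} (hP : IsClosedSeq P) {x₀ : A} (h₀ : x₀ ∈ P) :
    ∃ x, x₀ ≤ x ∧ Maximal (· ∈ P) x := by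
  refine zorn_le_nonempty₀ P (fun C hCP hC y hy => ?_) x₀ h₀
  obtain ⟨w, hw, hwC, hwt⟩ := exists_monotone_tendsto hC ⟨y, hy⟩
  obtain ⟨x, hx, hxt⟩ := exists_limit w hw
  refine ⟨x, hP w x hw (fun n => hCP (hwC n)) hx hxt, fun c hc => ?_⟩
  have hb : BddAbove (m '' C) := ⟨1, by rintro _ ⟨x, -, rfl⟩; exact m_le_one x⟩
  have hmx : m x = sSup (m '' C) := tendsto_nhds_unique hxt hwt
  by_cases h : ∃ n, c ≤ w n
  · obtain ⟨n, hn⟩ := h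
    exact hn.trans (hx n)
  · have hcw : ∀ n, w n ≤ c := fun n =>
      (hC.total (hwC n) hc).resolve_right fun h' => h ⟨n, h'⟩
    have hxc : x ≤ c := le_of_limit_le hx hxt hcw
    exact (eq_of_le_of_m_le hxc (hmx ▸ le_csSup hb ⟨c, hc, rfl⟩)).ge

/-- The elements below all upper bounds of S are closed under sequential limits and under joins with
members of S, so a maximal one is the supremum. -/
lemma exists_isLUB (S : Set A) : ∃ x, IsLUB S x := by
  have hP : IsClosedSeq {x : A | x ∈ lowerBounds (upperBounds S)} :=
    fun w x _ hwP hx hxt y hy => le_of_limit_le hx hxt fun n => hwP n hy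
  obtain ⟨x, -, hx⟩ := exists_maximal hP (x₀ := ⊥) (fun y _ => bot_le)
  refine ⟨x, fun s hs => ?_, hx.prop⟩
  have : x ⊔ s ∈ {x : A | x ∈ lowerBounds (upperBounds S)} :=
    fun y hy => sup_le (hx.prop hy) (hy hs)
  exact le_sup_right.trans (hx.le_of_ge this le_sup_left)

/-- A substitute for countable additivity. The elements that finite joins from S cover up to
arbitrarily small measure form a sequentially closed set; a maximal one absorbs every member of S,
hence dominates x. -/
lemma exists_finset_m_sdiff_lt {S : Set A} {x : A} (hx : IsLUB S x) {ε : ℝ} (hε : 0 < ε) :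
    ∃ F : Finset A, (F : Set A) ⊆ S ∧ m (x \ F.sup id) < ε := by
  classical
  have hP : IsClosedSeq {y : A | ∀ ε : ℝ, 0 < ε →
      ∃ F : Finset A, (F : Set A) ⊆ S ∧ m (y \ F.sup id) < ε} := by
    intro w y _ hwP hy hyt ε hε
    obtain ⟨n, hn⟩ := (hyt.eventually (lt_mem_nhds (show m y - ε / 2 < m y by linarith))).exists
    obtain ⟨F, hF, hlt⟩ := hwP n (ε / 2) (half_pos hε)
    refine ⟨F, hF, ?_⟩
    have h1 : y \ F.sup id ≤ (y \ w n) ⊔ (w n \ F.sup id) :=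
      sdiff_triangle _ _ _
    have h2 := m_mono h1
    have h3 := m_sup_le (y \ w n) (w n \ F.sup id)
    have h4 := m_sdiff (hy n)
    linarith
  obtain ⟨y, -, hy⟩ := exists_maximal hP (x₀ := ⊥)
    (fun ε hε => ⟨∅, by simp, by simpa [m_bot] using hε⟩)
  have hyS : ∀ s ∈ S, s ≤ y := by
    intro s hs
    refine le_sup_right.trans (hy.le_of_ge (y := y ⊔ s) (fun ε hε => ?_) le_sup_left)
    obtain ⟨F, hF, hlt⟩ := hy.prop ε hε
    refine ⟨insert s F, by simp [Set.insert_subset_iff, hs, hF], (m_mono ?_).trans_lt hlt⟩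
    rw [Finset.sup_insert, id, sup_sdiff, sdiff_eq_bot_iff.2 le_sup_left, sup_bot_eq]
    exact sdiff_le_sdiff_left le_sup_right
  obtain ⟨F, hF, hlt⟩ := hy.prop ε hε
  exact ⟨F, hF, (m_mono (sdiff_le_sdiff_right (hx.2 hyS))).trans_lt hlt⟩

/-! Atomless elements. -/

lemma exists_le_half {u : A} (hu : u ≠ ⊥) (hat : ∀ a, IsAtom a → ¬ a ≤ u) :
    ∃ e, e ≠ ⊥ ∧ e ≤ u ∧ m e ≤ m u / 2 := by
  have : ∃ b, b < u ∧ b ≠ ⊥ := by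
    by_contra! h
    exact hat u ⟨hu, h⟩ le_rfl
  obtain ⟨b, hb, hb0⟩ := this
  have h := m_sdiff hb.le
  by_cases h' : m b ≤ m u / 2
  · exact ⟨b, hb0, hb.le, h'⟩
  · exact ⟨u \ b, fun h0 => hb.not_ge (sdiff_eq_bot_iff.1 h0), sdiff_le, by linarith⟩

lemma exists_small {u : A} (hu : u ≠ ⊥) (hat : ∀ a, IsAtom a → ¬ a ≤ u) {ε : ℝ} (hε : 0 < ε) :
    ∃ e, e ≠ ⊥ ∧ e ≤ u ∧ m e ≤ ε := by
  have key : ∀ n : ℕ, ∃ e, e ≠ ⊥ ∧ e ≤ u ∧ m e ≤ (1 / 2 : ℝ) ^ n := by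
    intro n
    induction n with
    | zero => exact ⟨u, hu, le_rfl, by simpa using m_le_one u⟩
    | succ n ih =>
      obtain ⟨e, he, heu, hem⟩ := ih
      obtain ⟨f, hf, hfe, hfm⟩ := exists_le_half he fun a ha h => hat a ha (h.trans heu)
      exact ⟨f, hf, hfe.trans heu, by rw [pow_succ]; linarith⟩
  obtain ⟨n, hn⟩ := exists_pow_lt_of_lt_one hε (by norm_num : (1 / 2 : ℝ) < 1)
  obtain ⟨e, he, heu, hem⟩ := key n
  exact ⟨e, he, heu, hem.trans hn.le⟩

lemma exists_maximal_m_le (u : A) {r : ℝ} (hr : 0 ≤ r) :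
    ∃ c, Maximal (· ∈ {c : A | c ≤ u ∧ m c ≤ r}) c := by
  have hP : IsClosedSeq {c : A | c ≤ u ∧ m c ≤ r} := fun w x _ hw hx hxt =>
    ⟨le_of_limit_le hx hxt fun n => (hw n).1, le_of_tendsto' hxt fun n => (hw n).2⟩
  obtain ⟨c, -, hc⟩ := exists_maximal hP (x₀ := ⊥) ⟨bot_le, by rwa [m_bot]⟩
  exact ⟨c, hc⟩

/-- Otherwise c could be enlarged by e. This serves both the intermediate values of atomless
elements and the balanced partitions. -/
lemma lt_m_sup_of_maximal {u c e : A} {r : ℝ}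
    (hc : Maximal (· ∈ {c : A | c ≤ u ∧ m c ≤ r}) c) (he : e ≠ ⊥) (heu : e ≤ u \ c) :
    r < m c + m e := by
  have hd : Disjoint c e := disjoint_sdiff_self_right.mono_right heu
  rw [← m_sup c e hd]
  by_contra! h
  have : e ≤ c := le_sup_right.trans
    (hc.le_of_ge (y := c ⊔ e) ⟨sup_le hc.prop.1 (heu.trans sdiff_le), h⟩ le_sup_left)
  exact he (hd.eq_bot_of_ge this)

lemma m_eq_of_maximal {u c : A} {r : ℝ} (hru : r ≤ m u)
    (hc : Maximal (· ∈ {c : A | c ≤ u ∧ m c ≤ r}) c) (hat : ∀ a, IsAtom a → ¬ a ≤ u \ c) :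
    m c = r := by
  by_contra h
  have hlt : m c < r := lt_of_le_of_ne hc.prop.2 h
  have hne : u \ c ≠ ⊥ := by
    intro h0
    have := m_sdiff hc.prop.1
    rw [h0, m_bot] at this
    linarith
  obtain ⟨e, he, heu, hem⟩ := exists_small hne hat (sub_pos.2 hlt)
  have := lt_m_sup_of_maximal hc he heu
  linarith

/-- In an atomless element all intermediate measures are attained. -/
lemma exists_m_eq {u : A} (hat : ∀ a, IsAtom a → ¬ a ≤ u) {r : ℝ} (hr : 0 ≤ r)
    (hru : r ≤ m u) : ∃ c ≤ u, m c = r := by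
  obtain ⟨c, hc⟩ := exists_maximal_m_le u hr
  exact ⟨c, hc.prop.1, m_eq_of_maximal hru hc fun a ha h => hat a ha (h.trans sdiff_le)⟩

/-! Atoms. -/

lemma pairwiseDisjoint_atoms {s : Finset A} (hs : ∀ a ∈ s, IsAtom a) :
    (s : Set A).PairwiseDisjoint id := fun a ha b hb hab =>
  (hs a ha).disjoint_of_ne (hs b hb) hab

lemma sum_atoms_le {s : Finset A} {x : A} (hs : ∀ a ∈ s, IsAtom a ∧ a ≤ x) :
    ∑ a ∈ s, m a ≤ m x := by
  rw [← m_finset_sup s (fun a => a) (pairwiseDisjoint_atoms fun a ha => (hs a ha).1)]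
  exact m_mono (Finset.sup_le fun a ha => (hs a ha).2)

lemma finite_atoms_lt {r : ℝ} (hr : 0 < r) : {a : A | IsAtom a ∧ r < m a}.Finite := by
  by_contra h
  obtain ⟨k, hk⟩ := exists_nat_gt (1 / r)
  obtain ⟨s, hs, hcard⟩ := Set.Infinite.exists_subset_card_eq h k
  have h1 : ∑ a ∈ s, m a ≤ m (⊤ : A) := sum_atoms_le fun a ha => ⟨(hs ha).1, le_top⟩
  have h2 : s.card • r ≤ ∑ a ∈ s, m a := Finset.card_nsmul_le_sum _ _ _ fun a ha => (hs ha).2.le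
  rw [m_top] at h1
  rw [hcard, nsmul_eq_mul] at h2
  rw [div_lt_iff₀ hr] at hk
  linarith

lemma le_or_le_compl_of_isAtom {a : A} (ha : IsAtom a) (y : A) : a ≤ y ∨ a ≤ yᶜ := by
  by_cases h : a ≤ y
  · exact Or.inl h
  · exact Or.inr (ha.not_le_iff_disjoint.1 h).le_compl_right

end ProbabilityAlgebra

end ProbAlg

namespace ProbAlg

namespace ProbabilityAlgebra

variable {A : Type*} [ProbabilityAlgebra A]

/-! The greatest total measure of at most `k` atoms. -/

/-- Finite sets of at most `k` atoms below `x`. -/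
def AtomSets (k : ℕ) (x : A) : Set (Finset A) :=
  {s | s.card ≤ k ∧ ∀ a ∈ s, IsAtom a ∧ a ≤ x}

/-- The supremum of the total measures of at most `k` atoms below `x`. -/
noncomputable def topMass (k : ℕ) (x : A) : ℝ :=
  sSup ((fun s : Finset A => ∑ a ∈ s, m a) '' AtomSets k x)

lemma empty_mem_atomSets (k : ℕ) (x : A) : ∅ ∈ AtomSets k x := by simp [AtomSets]

lemma singleton_mem_atomSets {a x : A} (ha : IsAtom a) (h : a ≤ x) : {a} ∈ AtomSets 1 x := by
  simp [AtomSets, ha, h]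

lemma sum_le_topMass {k : ℕ} {x : A} {s : Finset A} (hs : s ∈ AtomSets k x) :
    ∑ a ∈ s, m a ≤ topMass k x :=
  le_csSup ⟨1, by rintro _ ⟨s, hs, rfl⟩; exact (sum_atoms_le hs.2).trans (m_le_one x)⟩
    ⟨s, hs, rfl⟩

lemma topMass_le {k : ℕ} {x : A} {r : ℝ} (h : ∀ s ∈ AtomSets k x, ∑ a ∈ s, m a ≤ r) :
    topMass k x ≤ r :=
  csSup_le ⟨_, ∅, empty_mem_atomSets k x, rfl⟩ (by rintro _ ⟨s, hs, rfl⟩; exact h s hs)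

lemma topMass_nonneg (k : ℕ) (x : A) : 0 ≤ topMass k x := by
  simpa using sum_le_topMass (empty_mem_atomSets k x)

lemma topMass_zero (x : A) : topMass 0 x = 0 := by
  refine le_antisymm (topMass_le fun s hs => ?_) (topMass_nonneg _ _)
  rw [Finset.card_eq_zero.1 (Nat.le_zero.1 hs.1), Finset.sum_empty]

lemma m_le_topMass_one {a x : A} (ha : IsAtom a) (h : a ≤ x) : m a ≤ topMass 1 x := by
  simpa using sum_le_topMass (singleton_mem_atomSets ha h)

lemma topMass_one_le {x : A} {r : ℝ} (hr : 0 ≤ r) (h : ∀ a, IsAtom a → a ≤ x → m a ≤ r) :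
    topMass 1 x ≤ r := by
  refine topMass_le fun s hs => ?_
  rcases s.eq_empty_or_nonempty with rfl | hne
  · simpa using hr
  · obtain ⟨a, rfl⟩ := Finset.card_eq_one.1 (le_antisymm hs.1 hne.card_pos)
    have := hs.2 a (by simp)
    simpa using h a this.1 this.2

/-- Atoms on different sides of w are distinct, so the two sets of atoms can be united. With
`exists_sum_le_topMass_add` this gives the recursion that the definition of φₙ mirrors. -/
lemma topMass_add_le (k : ℕ) (x w : A) :
    topMass k (x ⊓ w) + topMass 1 (x ⊓ wᶜ) ≤ topMass (k + 1) x := by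
  classical
  rw [← le_sub_iff_add_le]
  refine topMass_le fun s hs => ?_
  rw [le_sub_comm]
  refine topMass_le fun t ht => ?_
  rw [le_sub_iff_add_le, add_comm, ← Finset.sum_union]
  · refine sum_le_topMass ⟨(Finset.card_union_le _ _).trans (Nat.add_le_add hs.1 ht.1), ?_⟩
    intro a ha
    rcases Finset.mem_union.1 ha with h | h
    · exact ⟨(hs.2 a h).1, (hs.2 a h).2.trans inf_le_left⟩
    · exact ⟨(ht.2 a h).1, (ht.2 a h).2.trans inf_le_left⟩
  · refine Finset.disjoint_left.2 fun a has hat => (hs.2 a has).1.1 ?_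
    exact (disjoint_compl_right.mono ((hs.2 a has).2.trans inf_le_right)
      ((ht.2 a hat).2.trans inf_le_right)).eq_bot_of_self

lemma exists_sum_le_topMass_add {k : ℕ} {x : A} {s : Finset A} (hs : s ∈ AtomSets (k + 1) x) :
    ∃ w, ∑ a ∈ s, m a ≤ topMass k (x ⊓ w) + topMass 1 (x ⊓ wᶜ) := by
  classical
  rcases s.eq_empty_or_nonempty with rfl | ⟨b, hb⟩
  · exact ⟨⊤, by simpa using add_nonneg (topMass_nonneg _ _) (topMass_nonneg _ _)⟩
  -- The complement of one atom b of s separates b from the other atoms of s.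
  · refine ⟨bᶜ, ?_⟩
    rw [← Finset.sum_erase_add _ _ hb]
    refine add_le_add (sum_le_topMass ⟨?_, fun a ha => ?_⟩)
      (m_le_topMass_one (hs.2 b hb).1 (le_inf (hs.2 b hb).2 (compl_compl b).ge))
    · rw [Finset.card_erase_of_mem hb]
      exact Nat.sub_le_of_le_add hs.1
    · obtain ⟨hab, has⟩ := Finset.mem_erase.1 ha
      exact ⟨(hs.2 a has).1, le_inf (hs.2 a has).2
        ((hs.2 a has).1.disjoint_of_ne (hs.2 b hb).1 hab).le_compl_right⟩

/-- An atom below z lies either below x or below z \ x. -/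
lemma topMass_one_le_add (x z : A) : topMass 1 z ≤ topMass 1 x + m (z \ x) := by
  refine topMass_one_le (add_nonneg (topMass_nonneg _ _) (m_nonneg _)) fun a ha haz => ?_
  rcases le_or_le_compl_of_isAtom ha x with h | h
  · exact (m_le_topMass_one ha h).trans (le_add_of_nonneg_right (m_nonneg _))
  · exact (m_mono (le_inf haz h |>.trans sdiff_eq.ge)).trans
      (le_add_of_nonneg_left (topMass_nonneg _ _))

/-! Balanced partitions. -/

lemma exists_balanced (z : A) : ∃ y, |m (z ⊓ y) - m (z ⊓ yᶜ)| ≤ topMass 1 z := by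
  have hz := m_nonneg z
  have key : ∀ y ≤ z, m (z ⊓ y) - m (z ⊓ yᶜ) = 2 * m y - m z := fun y hy => by
    rw [← sdiff_eq, m_sdiff hy, inf_eq_right.2 hy]; ring
  -- Here c is a maximal part of at most half the measure. If an atom a remains outside c, adding it
  -- overshoots the half; the two imbalances sum to 2 m a, so one of c and c ⊔ a is balanced up to
  -- the largest atom. If no atom remains, c is exactly half.
  obtain ⟨c, hc⟩ := exists_maximal_m_le z (show 0 ≤ m z / 2 by linarith)
  by_cases hat : ∃ a, IsAtom a ∧ a ≤ z \ c
  · obtain ⟨a, ha, haz⟩ := hat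
    have hlt := lt_m_sup_of_maximal hc ha.1 haz
    have hle := hc.prop.2
    have hT := m_le_topMass_one ha (haz.trans sdiff_le)
    rcases le_total (m z - 2 * m c) (topMass 1 z) with h | h
    · refine ⟨c, ?_⟩
      rw [key c hc.prop.1, abs_le]
      constructor <;> linarith
    · refine ⟨c ⊔ a, ?_⟩
      rw [key _ (sup_le hc.prop.1 (haz.trans sdiff_le)),
        m_sup _ _ (disjoint_sdiff_self_right.mono_right haz), abs_le]
      constructor <;> linarith
  · push Not at hat
    refine ⟨c, ?_⟩
    rw [key c hc.prop.1, m_eq_of_maximal (by linarith) hc hat,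
      show 2 * (m z / 2) - m z = 0 by ring, abs_zero]
    exact topMass_nonneg _ _

lemma abs_sub_eq_of_isAtom {a : A} (ha : IsAtom a) (y : A) :
    |m (a ⊓ y) - m (a ⊓ yᶜ)| = m a := by
  rcases le_or_le_compl_of_isAtom ha y with h | h
  · rw [inf_eq_left.2 h, show a ⊓ yᶜ = ⊥ from
      (disjoint_compl_right.mono_left h).eq_bot, m_bot, sub_zero, abs_of_nonneg (m_nonneg a)]
  · rw [inf_eq_left.2 h, show a ⊓ y = ⊥ from (disjoint_compl_left.mono_left h).eq_bot, m_bot,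
      zero_sub, abs_neg, abs_of_nonneg (m_nonneg a)]

end ProbabilityAlgebra

end ProbAlg

namespace ProbAlg

/-! Functions with the same finite distribution differ by a bijection. -/

lemma eventually_forall_lt_imp_le {s : Set ℝ} (hs : s.Finite) {r : ℝ} :
    ∀ᶠ q in 𝓝[<] r, ∀ x ∈ s, q < x → r ≤ x := by
  refine (Set.Finite.eventually_all hs).2 fun x _ => ?_
  rcases lt_or_ge x r with h | h
  · filter_upwards [Ioo_mem_nhdsLT h] with q hq hqx using absurd hqx hq.1.not_gt
  · exact Eventually.of_forall fun _ _ => h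

/-- The bijection is glued from bijections of fibres. By finiteness no value lies strictly between r
and a suitable q < r, so the fibre over r is a difference of two superlevel sets and its cardinality
is determined. -/
lemma exists_equiv_of_ncard_eq {α β : Type*} (f : α → ℝ) (g : β → ℝ) (hf : ∀ a, 0 < f a)
    (hg : ∀ b, 0 < g b) (hff : ∀ r > 0, {a | r < f a}.Finite) (hgf : ∀ r > 0, {b | r < g b}.Finite)
    (h : ∀ r > 0, {a | r < f a}.ncard = {b | r < g b}.ncard) :
    ∃ e : α ≃ β, ∀ a, g (e a) = f a := by
  have fiber : ∀ r > 0, {a | f a = r}.Finite ∧ {b | g b = r}.Finite ∧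
      {a | f a = r}.ncard = {b | g b = r}.ncard := by
    intro r hr
    have hI : ∀ᶠ q in 𝓝[<] r, q ∈ Set.Ioo (r / 2) r := Ioo_mem_nhdsLT (half_lt_self hr)
    obtain ⟨q, ⟨hq, hqr⟩, hqf, hqg⟩ := (hI.and
        ((eventually_forall_lt_imp_le ((hff _ (half_pos hr)).image f) (r := r)).and
          (eventually_forall_lt_imp_le ((hgf _ (half_pos hr)).image g) (r := r)))).exists
    have hq0 : 0 < q := (half_pos hr).trans hq
    have ef : {a | f a = r} = {a | q < f a} \ {a | r < f a} := by
      ext a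
      simp only [Set.mem_ofPred_eq, Set.mem_sdiff, not_lt]
      refine ⟨fun h => ⟨h ▸ hqr, h.le⟩, fun h => le_antisymm h.2 ?_⟩
      exact hqf _ ⟨a, hq.trans h.1, rfl⟩ h.1
    have eg : {b | g b = r} = {b | q < g b} \ {b | r < g b} := by
      ext a
      simp only [Set.mem_ofPred_eq, Set.mem_sdiff, not_lt]
      refine ⟨fun h => ⟨h ▸ hqr, h.le⟩, fun h => le_antisymm h.2 ?_⟩
      exact hqg _ ⟨a, hq.trans h.1, rfl⟩ h.1
    refine ⟨ef ▸ (hff q hq0).sdiff, eg ▸ (hgf q hq0).sdiff, ?_⟩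
    rw [ef, eg, Set.ncard_sdiff (show {a | r < f a} ⊆ {a | q < f a} from fun a ha => hqr.trans ha)
      (hff r hr), Set.ncard_sdiff (show {b | r < g b} ⊆ {b | q < g b} from
      fun a ha => hqr.trans ha) (hgf r hr), h q hq0, h r hr]
  have key : ∀ r, Nonempty ({a // f a = r} ≃ {b // g b = r}) := by
    intro r
    rcases lt_or_ge 0 r with hr | hr
    · obtain ⟨h1, h2, h3⟩ := fiber r hr
      have : Finite {a // f a = r} := h1
      have : Finite {b // g b = r} := h2
      exact Finite.card_eq.1 h3
    · have : IsEmpty {a // f a = r} := ⟨fun a => ((hf a).trans_le (a.2.le.trans hr)).false⟩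
      have : IsEmpty {b // g b = r} := ⟨fun a => ((hg a).trans_le (a.2.le.trans hr)).false⟩
      exact ⟨Equiv.equivOfIsEmpty _ _⟩
  let e : α ≃ β := (Equiv.sigmaFiberEquiv f).symm.trans
    ((Equiv.sigmaCongrRight fun r => (key r).some).trans (Equiv.sigmaFiberEquiv g))
  exact ⟨e, fun a => ((key (f a)).some ⟨a, rfl⟩).2⟩

/-! ### Matching elements of two algebras along a bijection of their atoms. -/

namespace ProbabilityAlgebra

variable {A B : Type*} [ProbabilityAlgebra A] [ProbabilityAlgebra B]

/-- The atoms of `A`. -/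
abbrev Atoms (A : Type*) [ProbabilityAlgebra A] : Type _ := {a : A // IsAtom a}

lemma le_sup_iff_of_isAtom {x x' a : A} (ha : IsAtom a) : a ≤ x ⊔ x' ↔ a ≤ x ∨ a ≤ x' := by
  refine ⟨fun h => ?_, fun h => h.elim le_sup_of_le_left le_sup_of_le_right⟩
  by_contra! h'
  have h1 := (ha.not_le_iff_disjoint.1 h'.1).sup_right (ha.not_le_iff_disjoint.1 h'.2)
  exact ha.not_le_iff_disjoint.2 h1 h

lemma le_sdiff_iff_of_isAtom {x x' a : A} (ha : IsAtom a) : a ≤ x \ x' ↔ a ≤ x ∧ ¬ a ≤ x' := by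
  rw [le_sdiff, ha.not_le_iff_disjoint]

/-- `x` and `y` have the same measure and contain the same atoms, up to `π`. -/
def Matched (π : Atoms A ≃ Atoms B) (x : A) (y : B) : Prop :=
  m x = m y ∧ ∀ a : Atoms A, a.1 ≤ x ↔ (π a).1 ≤ y

namespace Matched

variable {π : Atoms A ≃ Atoms B} {x x' : A} {y y' : B}

lemma symm (h : Matched π x y) : Matched π.symm y x :=
  ⟨h.1.symm, fun b => by rw [h.2, π.apply_symm_apply]⟩

lemma bot : Matched π (⊥ : A) (⊥ : B) :=
  ⟨m_bot.trans m_bot.symm, fun a => by simp [a.2.1, (π a).2.1]⟩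

lemma top : Matched π (⊤ : A) (⊤ : B) := ⟨m_top.trans m_top.symm, fun a => by simp⟩

lemma sup (h : Matched π x y) (h' : Matched π x' y') (hx : Disjoint x x') (hy : Disjoint y y') :
    Matched π (x ⊔ x') (y ⊔ y') := by
  refine ⟨by rw [m_sup _ _ hx, m_sup _ _ hy, h.1, h'.1], fun a => ?_⟩
  rw [le_sup_iff_of_isAtom a.2, le_sup_iff_of_isAtom (π a).2, h.2, h'.2]

lemma sdiff (h : Matched π x y) (h' : Matched π x' y') (hx : x' ≤ x) (hy : y' ≤ y) :
    Matched π (x \ x') (y \ y') := by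
  refine ⟨by rw [m_sdiff hx, m_sdiff hy, h.1, h'.1], fun a => ?_⟩
  rw [le_sdiff_iff_of_isAtom a.2, le_sdiff_iff_of_isAtom (π a).2, h.2, h'.2]

lemma finset_sup {ι : Type*} {p : ι → A} {q : ι → B} (h : ∀ i, Matched π (p i) (q i))
    (hp : Pairwise fun i j => Disjoint (p i) (p j)) (hq : Pairwise fun i j => Disjoint (q i) (q j))
    (s : Finset ι) : Matched π (s.sup p) (s.sup q) := by
  classical
  induction s using Finset.induction_on with
  | empty => exact bot
  | insert i s hi ih =>
    rw [Finset.sup_insert, Finset.sup_insert]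
    refine (h i).sup ih (Finset.disjoint_sup_right.2 fun j hj => hp ?_)
      (Finset.disjoint_sup_right.2 fun j hj => hq ?_) <;>
    · rintro rfl
      exact hi hj

end Matched

/-- The union of all atoms below `x`. -/
noncomputable def atomicPart (x : A) : A := (exists_isLUB {a : A | IsAtom a ∧ a ≤ x}).choose

lemma isLUB_atomicPart (x : A) : IsLUB {a : A | IsAtom a ∧ a ≤ x} (atomicPart x) :=
  (exists_isLUB {a : A | IsAtom a ∧ a ≤ x}).choose_spec

lemma atomicPart_le (x : A) : atomicPart x ≤ x := (isLUB_atomicPart x).2 fun _ h => h.2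

lemma not_le_sdiff_atomicPart {x a : A} (ha : IsAtom a) : ¬ a ≤ x \ atomicPart x := by
  rw [le_sdiff_iff_of_isAtom ha]
  exact fun h => h.2 ((isLUB_atomicPart x).1 ⟨ha, h.1⟩)

/-- An atom below the union of a family of atoms belongs to the family. -/
lemma mem_of_le_isLUB {S : Set A} (hS : ∀ a ∈ S, IsAtom a) {x a : A} (hx : IsLUB S x)
    (ha : IsAtom a) (h : a ≤ x) : a ∈ S := by
  by_contra haS
  have : x ≤ aᶜ := hx.2 fun b hb =>
    ((hS b hb).disjoint_of_ne ha fun h => haS (h ▸ hb)).le_compl_right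
  exact ha.1 ((disjoint_compl_right (a := a)).eq_bot_of_le (h.trans this))

/-- Finitely many atoms of S exhaust x up to ε, and their images are distinct atoms below y of the
same total mass. -/
lemma m_le_of_isLUB_atoms {π : Atoms A ≃ Atoms B} (hπ : ∀ a, m (π a).1 = m a.1) {x : A} {y : B}
    {S : Set A} (hS : ∀ a ∈ S, IsAtom a) (hx : IsLUB S x)
    (hy : ∀ a : Atoms A, a.1 ∈ S → (π a).1 ≤ y) : m x ≤ m y := by
  classical
  refine le_of_forall_pos_le_add fun ε hε => ?_
  obtain ⟨F, hF, hlt⟩ := exists_finset_m_sdiff_lt hx hε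
  have hFx : F.sup id ≤ x := Finset.sup_le fun a ha => hx.1 (hF ha)
  rw [m_sdiff hFx, m_finset_sup _ _ (pairwiseDisjoint_atoms fun a ha => hS a (hF ha))] at hlt
  have hle : ∑ b ∈ (F.subtype IsAtom).map (π.toEmbedding.trans (.subtype _)), m b ≤ m y := by
    refine sum_atoms_le fun b hb => ?_
    obtain ⟨a, ha, rfl⟩ := Finset.mem_map.1 hb
    exact ⟨(π a).2, hy a (hF (Finset.mem_subtype.1 ha))⟩
  rw [Finset.sum_map] at hle
  simp only [Function.Embedding.trans_apply, Equiv.coe_toEmbedding,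
    Function.Embedding.subtype_apply, hπ] at hle
  rw [Finset.sum_subtype_of_mem (fun a => m a) fun a ha => hS a (hF ha)] at hle
  simp only [id] at hlt
  linarith

lemma Matched.m_atomicPart {π : Atoms A ≃ Atoms B} (hπ : ∀ a, m (π a).1 = m a.1) {x : A} {y : B}
    (h : Matched π x y) : m (atomicPart x) = m (atomicPart y) := by
  refine le_antisymm (m_le_of_isLUB_atoms hπ (fun a ha => ha.1) (isLUB_atomicPart x) fun a ha =>
    (isLUB_atomicPart y).1 ⟨(π a).2, (h.2 a).1 ha.2⟩)
    (m_le_of_isLUB_atoms (π := π.symm) (fun b => ?_) (fun a ha => ha.1) (isLUB_atomicPart y)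
      fun b hb => (isLUB_atomicPart x).1 ⟨(π.symm b).2, (h.symm.2 b).1 hb.2⟩)
  rw [← hπ, π.apply_symm_apply]

/-- The forth step: an element below `x` has a counterpart below `y`. -/
lemma Matched.exists_le {π : Atoms A ≃ Atoms B} (hπ : ∀ a, m (π a).1 = m a.1) {x c : A} {y : B}
    (h : Matched π x y) (hc : c ≤ x) : ∃ d ≤ y, Matched π c d := by
  have hS : ∀ b ∈ {b : B | ∃ a : Atoms A, a.1 ≤ c ∧ (π a).1 = b}, IsAtom b := by
    rintro _ ⟨a, -, rfl⟩
    exact (π a).2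
  -- D is the counterpart of the atomic part of c: it contains exactly the images of the atoms below
  -- c.
  obtain ⟨D, hD⟩ := exists_isLUB {b : B | ∃ a : Atoms A, a.1 ≤ c ∧ (π a).1 = b}
  have hDle : ∀ a : Atoms A, (π a).1 ≤ D ↔ a.1 ≤ c := by
    refine fun a => ⟨fun hle => ?_, fun hle => hD.1 ⟨a, hle, rfl⟩⟩
    obtain ⟨a', ha', he⟩ := mem_of_le_isLUB hS hD (π a).2 hle
    rwa [← π.injective (Subtype.ext he)]
  have hDy : D ≤ atomicPart y := hD.2 <| by
    rintro _ ⟨a, ha, rfl⟩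
    exact (isLUB_atomicPart y).1 ⟨(π a).2, (h.2 a).1 (ha.trans hc)⟩
  have hmD : m (atomicPart c) = m D := by
    refine le_antisymm (m_le_of_isLUB_atoms hπ (fun a ha => ha.1) (isLUB_atomicPart c) fun a ha =>
      (hDle a).2 ha.2) (m_le_of_isLUB_atoms (π := π.symm) (fun b => ?_) hS hD fun b hb =>
        (isLUB_atomicPart c).1 ⟨(π.symm b).2, ?_⟩)
    · rw [← hπ, π.apply_symm_apply]
    · obtain ⟨a, ha, he⟩ := hb
      rw [← Subtype.ext he, π.symm_apply_apply]
      exact ha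
  -- The atomless part of c lies in that of x, whose measure equals that of the atomless part of y.
  -- So y has room for an atomless e with the mass still missing from D.
  have hle : c \ atomicPart c ≤ x \ atomicPart x := by
    refine le_sdiff.2 ⟨sdiff_le.trans hc, ?_⟩
    rw [disjoint_comm, ← le_compl_iff_disjoint_right]
    refine (isLUB_atomicPart x).2 fun a ha => ?_
    exact (ha.1.not_le_iff_disjoint.1 (not_le_sdiff_atomicPart ha.1)).le_compl_right
  have hmle : m (c \ atomicPart c) ≤ m (y \ atomicPart y) := by
    have h1 := m_mono hle
    rw [m_sdiff (atomicPart_le x), h.1, h.m_atomicPart hπ] at h1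
    rwa [m_sdiff (atomicPart_le y)]
  obtain ⟨e, he, hme⟩ := exists_m_eq (u := y \ atomicPart y)
    (fun a ha => not_le_sdiff_atomicPart ha) (m_nonneg _) hmle
  refine ⟨D ⊔ e, sup_le (hDy.trans (atomicPart_le y)) (he.trans sdiff_le), ?_, fun a => ?_⟩
  · rw [m_sup D e (disjoint_sdiff_self_right.mono hDy he), hme, m_sdiff (atomicPart_le c), hmD]
    ring
  · rw [le_sup_iff_of_isAtom (π a).2, hDle, or_iff_left]
    exact fun hae => not_le_sdiff_atomicPart (π a).2 (hae.trans he)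

/-! Finite partitions. -/

/-- `p` is a partition of unity (empty pieces are allowed). -/
def IsPartition {ι : Type*} [Fintype ι] (p : ι → A) : Prop :=
  (Pairwise fun i j => Disjoint (p i) (p j)) ∧ Finset.univ.sup p = ⊤

namespace IsPartition

variable {ι : Type*} [Fintype ι] [DecidableEq ι] {p : ι → A}

/-- With `sup_compl`, this makes s ↦ s.sup p a Boolean homomorphism, so terms in unions of pieces
evaluate to unions of pieces. -/
lemma sup_inter (hp : IsPartition p) (s t : Finset ι) : (s ∩ t).sup p = s.sup p ⊓ t.sup p := by
  refine le_antisymm (le_inf (Finset.sup_mono Finset.inter_subset_left)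
    (Finset.sup_mono Finset.inter_subset_right)) ?_
  rw [Finset.sup_inf_sup]
  refine Finset.sup_le fun i hi => ?_
  obtain ⟨h1, h2⟩ := Finset.mem_product.1 hi
  by_cases h : i.1 = i.2
  · exact inf_le_left.trans (Finset.le_sup (Finset.mem_inter.2 ⟨h1, h ▸ h2⟩))
  · rw [(hp.1 h).eq_bot]
    exact bot_le

lemma sup_compl (hp : IsPartition p) (s : Finset ι) : (sᶜ).sup p = (s.sup p)ᶜ := by
  refine (IsCompl.compl_eq ⟨?_, ?_⟩).symm
  · rw [disjoint_iff, ← hp.sup_inter, Finset.inter_compl, Finset.sup_empty]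
  · rw [codisjoint_iff, ← Finset.sup_union, Finset.union_compl, hp.2]

end IsPartition

end ProbabilityAlgebra

end ProbAlg

namespace ProbAlg

/-! Values in `[0,1]`. -/

section

variable {M : Type u} [LprStructure M] {n : ℕ} (φ ψ : Formula n) (a : Fin n → M)

/-- Since values lie in [0,1], only the lower truncation of `Set.projIcc` can act. -/
lemma eval_sub : ((φ.sub ψ).eval M a : ℝ) = max 0 ((φ.eval M a : ℝ) - ψ.eval M a) := by
  have h1 := (φ.eval M a).2.2
  have h2 := (ψ.eval M a).2.1
  change max 0 (min 1 ((φ.eval M a : ℝ) - ψ.eval M a)) = _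
  rw [min_eq_right (by linarith)]

lemma eval_add : ((φ.add ψ).eval M a : ℝ) = min 1 ((φ.eval M a : ℝ) + ψ.eval M a) := by
  have h1 := (φ.eval M a).2.1
  have h2 := (ψ.eval M a).2.1
  change max 0 (min 1 ((φ.eval M a : ℝ) + ψ.eval M a)) = _
  exact max_eq_right (le_min zero_le_one (add_nonneg h1 h2))

lemma eval_absDiff : ((φ.absDiff ψ).eval M a : ℝ) = |(φ.eval M a : ℝ) - ψ.eval M a| := by
  have h1 := (φ.eval M a).2
  have h2 := (ψ.eval M a).2
  change max 0 (min 1 |(φ.eval M a : ℝ) - ψ.eval M a|) = _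
  rw [min_eq_right, max_eq_right (abs_nonneg _)]
  rw [abs_le]
  constructor <;> linarith [h1.1, h1.2, h2.1, h2.2]

lemma eval_eqConst_eq_zero (r : unitInterval) : (φ.eqConst r).eval M a = 0 ↔ φ.eval M a = r := by
  rw [Subtype.ext_iff, Formula.eqConst, eval_absDiff, Set.Icc.coe_zero, abs_eq_zero, sub_eq_zero,
    ← Subtype.ext_iff]
  rfl

lemma eval_dist (s t : Term n) :
    ((Formula.dist s t).eval M a : ℝ) = dist (s.eval M a) (t.eval M a) := rfl

lemma eval_mu (t : Term n) : (Formula.mu t).eval M a = LprStructure.mu (t.eval M a) := rfl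

lemma eval_sup_eq_zero (φ : Formula (n + 1)) :
    φ.sup.eval M a = 0 ↔ ∀ x : M, φ.eval M (Fin.snoc (α := fun _ => M) a x) = 0 :=
  iSup_eq_bot

lemma eval_dist_eq_zero (s t : Term n) :
    (Formula.dist s t).eval M a = 0 ↔ s.eval M a = t.eval M a := by
  rw [Subtype.ext_iff, eval_dist, Set.Icc.coe_zero, dist_eq_zero]

lemma eval_sub_eq_zero : (φ.sub ψ).eval M a = 0 ↔ φ.eval M a ≤ ψ.eval M a := by
  rw [Subtype.ext_iff, eval_sub, Set.Icc.coe_zero, max_eq_left_iff, sub_nonpos]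
  rfl

lemma eval_absDiff_eq_zero : (φ.absDiff ψ).eval M a = 0 ↔ φ.eval M a = ψ.eval M a := by
  rw [Subtype.ext_iff, eval_absDiff, Set.Icc.coe_zero, abs_eq_zero, sub_eq_zero,
    ← Subtype.ext_iff]

end

/-! Models of `Pr` are probability algebras. -/

section PrAxioms

open LprStructure Filter Topology

variable {M : Type u} [LprStructure M]

lemma boolean_of_models (h : Models M Pr) :
    (∀ x y : M, union x y = union y x) ∧ (∀ x y : M, inter x y = inter y x) ∧
    (∀ x y z : M, union x (union y z) = union (union x y) z) ∧
    (∀ x y z : M, inter x (inter y z) = inter (inter x y) z) ∧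
    (∀ x y : M, union x (inter x y) = x) ∧ (∀ x y : M, inter x (union x y) = x) ∧
    (∀ x y z : M, inter x (union y z) = union (inter x y) (inter x z)) ∧
    (∀ x y z : M, union x (inter y z) = inter (union x y) (union x z)) ∧
    (∀ x : M, union x zero = x) ∧ (∀ x : M, inter x one = x) ∧
    (∀ x : M, union x (compl x) = one) ∧ (∀ x : M, inter x (compl x) = zero) := by
  have h' : ∀ σ ∈ booleanAxioms, Sentence.value M σ = 0 := fun σ hσ => h σ (Or.inl (Or.inl hσ))
  simp only [booleanAxioms, Set.mem_insert_iff, Set.mem_singleton_iff, forall_eq_or_imp,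
    forall_eq, Sentence.value, eval_sup_eq_zero, eval_dist_eq_zero] at h'
  exact h'

lemma measure_of_models (h : Models M Pr) :
    mu (zero : M) = 0 ∧ mu (one : M) = 1 ∧ (∀ x y : M, mu (inter x y) ≤ mu x) ∧
    (∀ x y : M, mu x ≤ mu (union x y)) ∧
    (∀ x y : M, (mu x : ℝ) - mu (inter x y) = mu (union x y) - mu y) ∧
    (∀ x y : M, dist x y = mu (union (inter x (compl y)) (inter (compl x) y))) := by
  have h' : ∀ σ ∈ measureAxioms, Sentence.value M σ = 0 := fun σ hσ => h σ (Or.inl (Or.inr hσ))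
  simp only [measureAxioms, Set.mem_insert_iff, Set.mem_singleton_iff, forall_eq_or_imp,
    forall_eq, Sentence.value, eval_sup_eq_zero, eval_mu, eval_eqConst_eq_zero, eval_sub_eq_zero,
    eval_absDiff_eq_zero] at h'
  obtain ⟨h1, h2, h3, h4, h5⟩ := h'
  have h3' : ∀ x y : M, mu (inter x y) ≤ mu x := h3
  have h4' : ∀ x y : M, mu x ≤ mu (union x y) := h4
  refine ⟨h1, h2, h3, h4, fun x y => ?_, fun x y => ?_⟩
  -- Monotonicity of μ turns both truncated differences into true ones.
  · have h6 := congrArg Subtype.val (h5 x y)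
    rw [eval_sub, eval_sub] at h6
    change max 0 ((mu x : ℝ) - mu (inter x y)) = max 0 ((mu (union x y) : ℝ) - mu y) at h6
    have h7 : (mu (inter x y) : ℝ) ≤ mu x := h3' x y
    have h8 : (mu y : ℝ) ≤ mu (union x y) := (boolean_of_models h).1 y x ▸ h4' y x
    rwa [max_eq_right (sub_nonneg.2 h7), max_eq_right (sub_nonneg.2 h8)] at h6
  · have h' := h metricAxiom (Or.inr rfl)
    simp only [metricAxiom, Sentence.value, eval_sup_eq_zero, eval_absDiff_eq_zero] at h'
    exact congrArg Subtype.val (h' x y)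

/-- The Boolean algebra of a model of `Pr`. -/
@[reducible] noncomputable def booleanAlgebraOfModels (h : Models M Pr) : BooleanAlgebra M :=
  have hb := boolean_of_models h
  letI : Max M := ⟨union⟩
  letI : Min M := ⟨inter⟩
  letI L : Lattice M := Lattice.mk' hb.1 (fun a b c => (hb.2.2.1 a b c).symm) hb.2.1
    (fun a b c => (hb.2.2.2.1 a b c).symm) hb.2.2.2.2.1 hb.2.2.2.2.2.1
  letI D : DistribLattice M := DistribLattice.ofInfSupLe fun a b c => (hb.2.2.2.2.2.2.1 a b c).le
  { D with
    compl := compl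
    bot := zero
    top := one
    bot_le := fun a => sup_eq_left.1 (hb.2.2.2.2.2.2.2.2.1 a)
    le_top := fun a => inf_eq_left.1 (hb.2.2.2.2.2.2.2.2.2.1 a)
    inf_compl_le_bot := fun a => (hb.2.2.2.2.2.2.2.2.2.2.2 a).le
    top_le_sup_compl := fun a => (hb.2.2.2.2.2.2.2.2.2.2.1 a).ge }

noncomputable instance [h : Fact (Models M Pr)] : BooleanAlgebra M := booleanAlgebraOfModels h.out

section

variable [hM : Fact (Models M Pr)] (x y : M)

lemma inter_eq_inf : inter x y = x ⊓ y := rfl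

lemma compl_eq_compl : LprStructure.compl x = xᶜ := rfl

lemma one_eq_top : (one : M) = ⊤ := rfl

lemma dist_eq_mu_symmDiff : dist x y = mu (symmDiff x y) := by
  rw [(measure_of_models hM.out).2.2.2.2.2 x y, symmDiff, sdiff_eq, sdiff_eq, inf_comm y]
  rfl

lemma mu_bot : (mu (⊥ : M) : ℝ) = 0 := congrArg Subtype.val (measure_of_models hM.out).1

lemma mu_sup_of_disjoint {x y : M} (h : Disjoint x y) : (mu (x ⊔ y) : ℝ) = mu x + mu y := by
  have h' : (mu x : ℝ) - mu (x ⊓ y) = mu (x ⊔ y) - mu y :=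
    (measure_of_models hM.out).2.2.2.2.1 x y
  rw [h.eq_bot, mu_bot] at h'
  linarith

lemma mu_inf_add_mu_sdiff : (mu (x ⊓ y) : ℝ) + mu (x \ y) = mu x := by
  rw [← mu_sup_of_disjoint disjoint_inf_sdiff, sup_inf_sdiff]

lemma mu_mono {x y : M} (h : x ≤ y) : (mu x : ℝ) ≤ mu y := by
  have := mu_inf_add_mu_sdiff y x
  rw [inf_eq_right.2 h] at this
  linarith [(mu (y \ x)).2.1]

lemma dist_eq_add : dist x y = mu (x \ y) + mu (y \ x) := by
  rw [dist_eq_mu_symmDiff, symmDiff, mu_sup_of_disjoint disjoint_sdiff_sdiff]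

lemma abs_mu_sub_le : |(mu x : ℝ) - mu y| ≤ dist x y := by
  have h1 := mu_inf_add_mu_sdiff x y
  have h2 := mu_inf_add_mu_sdiff y x
  have h3 := (mu (x \ y)).2.1
  have h4 := (mu (y \ x)).2.1
  rw [inf_comm] at h2
  rw [dist_eq_add, abs_le]
  constructor <;> linarith

lemma mu_pos {x : M} (hx : x ≠ ⊥) : (0 : ℝ) < mu x := by
  have := dist_pos.2 hx
  rwa [dist_eq_mu_symmDiff, symmDiff_bot] at this

lemma dist_of_le {x y : M} (h : x ≤ y) : dist x y = mu y - mu x := by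
  have := mu_inf_add_mu_sdiff y x
  rw [inf_eq_right.2 h] at this
  rw [dist_eq_add, sdiff_eq_bot_iff.2 h, mu_bot]
  linarith

lemma tendsto_mu {w : ℕ → M} {x : M} (h : Tendsto w atTop (𝓝 x)) :
    Tendsto (fun n => (mu (w n) : ℝ)) atTop (𝓝 (mu x)) := by
  rw [tendsto_iff_dist_tendsto_zero] at h ⊢
  exact squeeze_zero (fun _ => dist_nonneg) (fun n => abs_mu_sub_le (w n) x) h

lemma exists_limit_of_monotone (w : ℕ → M) (hw : Monotone w) :
    ∃ x, (∀ n, w n ≤ x) ∧ Tendsto (fun n => (mu (w n) : ℝ)) atTop (𝓝 (mu x)) := by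
  have hmono : Monotone fun n => (mu (w n) : ℝ) := fun i j hij => mu_mono (hw hij)
  have hlim := tendsto_atTop_ciSup hmono ⟨1, by rintro _ ⟨n, rfl⟩; exact (mu (w n)).2.2⟩
  -- The distance of comparable elements is the difference of their measures, and these converge.
  have hcauchy : CauchySeq w := by
    rw [Metric.cauchySeq_iff']
    intro ε hε
    obtain ⟨N, hN⟩ := Metric.cauchySeq_iff'.1 hlim.cauchySeq ε hε
    refine ⟨N, fun n hn => ?_⟩
    rw [dist_comm, dist_of_le (hw hn)]
    exact (le_abs_self _).trans_lt (hN n hn)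
  obtain ⟨x, hx⟩ := cauchySeq_tendsto_of_complete hcauchy
  refine ⟨x, fun n => ?_, tendsto_mu hx⟩
  -- For k ≥ n, the measure of w n \ x is at most that of w k \ x, hence at most the distance from w
  -- k to x.
  have h0 : (mu (w n \ x) : ℝ) ≤ 0 := by
    refine ge_of_tendsto (tendsto_iff_dist_tendsto_zero.1 hx) ?_
    filter_upwards [eventually_ge_atTop n] with k hk
    rw [dist_eq_add]
    linarith [mu_mono (sdiff_le_sdiff_right (c := x) (hw hk)), (mu (x \ w k)).2.1]
  by_contra h
  exact (mu_pos fun h' => h (sdiff_eq_bot_iff.1 h')).not_ge h0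

noncomputable instance : ProbabilityAlgebra M where
  m x := mu x
  m_bot := mu_bot
  m_top := congrArg Subtype.val (measure_of_models hM.out).2.1
  m_sup _ _ := mu_sup_of_disjoint
  m_pos _ := mu_pos
  exists_limit := exists_limit_of_monotone

lemma isContained_iff : IsContained x y ↔ x ≤ y := inf_eq_left

lemma isAtomEvent_iff : IsAtomEvent x ↔ IsAtom x := by
  have h0 : ∀ z : M, mu z = 0 ↔ z = ⊥ := fun z =>
    ⟨fun h => ProbabilityAlgebra.m_eq_zero (congrArg Subtype.val h),
      fun h => h ▸ (measure_of_models hM.out).1⟩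
  have h1 : ∀ y : M, inter x (LprStructure.compl y) = ⊥ ↔ x ≤ y := fun y => by
    rw [inter_eq_inf, compl_eq_compl, ← sdiff_eq, sdiff_eq_bot_iff]
  simp only [IsAtomEvent, isContained_iff, h0, h1, pos_iff_ne_zero, ne_eq]
  refine and_congr_right fun _ => forall_congr' fun b => ?_
  rw [lt_iff_le_not_ge, and_imp]
  exact forall_congr' fun _ => or_iff_not_imp_right

end

end PrAxioms

end ProbAlg

/-! ### The values of χ, ψ and φₙ in a model of `Pr`. -/

namespace ProbAlg

open ProbabilityAlgebra

section

variable {M : Type u} [LprStructure M] {n : ℕ}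

lemma eval_lift (t : Term n) (a : Fin n → M) (x : M) :
    t.lift.eval M (Fin.snoc (α := fun _ => M) a x) = t.eval M a := by
  induction t with
  | var i => exact Fin.snoc_castSucc (α := fun _ => M) x a i
  | zero => rfl
  | one => rfl
  | compl t ih => exact congrArg _ ih
  | inter s t ihs iht => exact congrArg₂ _ ihs iht
  | union s t ihs iht => exact congrArg₂ _ ihs iht

lemma eval_last (a : Fin n → M) (x : M) :
    (Term.last : Term (n + 1)).eval M (Fin.snoc (α := fun _ => M) a x) = x :=
  Fin.snoc_last (α := fun _ => M) x a

lemma coe_eval_inf_le (a : Fin n → M) (φ : Formula (n + 1)) (x : M) :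
    (φ.inf.eval M a : ℝ) ≤ φ.eval M (Fin.snoc (α := fun _ => M) a x) :=
  iInf_le (fun x : M => φ.eval M (Fin.snoc (α := fun _ => M) a x)) x

lemma le_coe_eval_inf (a : Fin n → M) (φ : Formula (n + 1)) {r : ℝ}
    (h : ∀ x : M, r ≤ φ.eval M (Fin.snoc (α := fun _ => M) a x)) : r ≤ φ.inf.eval M a := by
  rcases le_or_gt r 0 with h0 | h0
  · exact h0.trans (φ.inf.eval M a).2.1
  · have h1 : r ≤ 1 := (h LprStructure.zero).trans (unitInterval.le_one _)
    exact le_iInf (a := (⟨r, h0.le, h1⟩ : unitInterval)) fun x => h x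

end

section

variable {M : Type u} [LprStructure M] [hM : Fact (Models M Pr)] {n : ℕ} (a : Fin n → M)

lemma coe_eval_mu (t : Term n) : ((Formula.mu t).eval M a : ℝ) = m (t.eval M a) := rfl

lemma eval_inter (s t : Term n) : (s.inter t).eval M a = s.eval M a ⊓ t.eval M a := rfl

lemma eval_compl (t : Term n) : t.compl.eval M a = (t.eval M a)ᶜ := rfl

lemma eval_absDiff_mu (t : Term n) (y : M) :
    ((Formula.absDiff (.mu (.inter t.lift .last)) (.mu (.inter t.lift (.compl .last)))).eval M
      (Fin.snoc (α := fun _ => M) a y) : ℝ) =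
      |m (t.eval M a ⊓ y) - m (t.eval M a ⊓ yᶜ)| := by
  rw [eval_absDiff, coe_eval_mu, coe_eval_mu, eval_inter, eval_inter, eval_compl, eval_lift,
    eval_last]

lemma eval_chi_le (t : Term n) : ((chi t).eval M a : ℝ) ≤ topMass 1 (t.eval M a) := by
  obtain ⟨y, hy⟩ := exists_balanced (t.eval M a)
  refine (coe_eval_inf_le a _ y).trans ?_
  rwa [eval_absDiff_mu]

lemma eval_psi (t : Term n) :
    ((psi t).eval M a : ℝ) = max 0 (m (t.eval M a) - (chi t).eval M a) := eval_sub _ _ a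

lemma le_eval_psi (t : Term n) :
    m (t.eval M a) - topMass 1 (t.eval M a) ≤ (psi t).eval M a := by
  rw [eval_psi]
  exact le_max_of_le_right (sub_le_sub_left (eval_chi_le a t) _)

lemma eval_psi_of_isAtom_or_bot (t : Term n) (h : IsAtom (t.eval M a) ∨ t.eval M a = ⊥) :
    ((psi t).eval M a : ℝ) = 0 := by
  rw [eval_psi, max_eq_left_iff, sub_nonpos]
  rcases h with h | h
  · refine le_coe_eval_inf a _ fun y => ?_
    rw [eval_absDiff_mu, abs_sub_eq_of_isAtom h]
  · rw [h, m_bot]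
    exact unitInterval.nonneg _

lemma dist_eq_m_add_m (x y : M) : dist x y = m (x \ y) + m (y \ x) := dist_eq_add x y

/-- For the upper bound, z runs over ⊥ and the atoms below x, where ψ vanishes and d(x, z) = m x - m
z. For the lower bound, ψ(z) is at least m z - `topMass 1 z`, and passing from z to x changes
`topMass 1` by at most m (z \ x), which d(x, z) pays for. -/
lemma eval_phi_zero (t : Term n) :
    ((phi 0 t).eval M a : ℝ) = m (t.eval M a) - topMass 1 (t.eval M a) := by
  have hphi : phi 0 t = .inf (.add (.dist t.lift .last) (psi .last)) := by rw [phi]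
  rw [hphi]
  set x := t.eval M a with hx
  have hbody : ∀ z : M, ((Formula.add (.dist t.lift .last) (psi .last)).eval M
      (Fin.snoc (α := fun _ => M) a z) : ℝ) =
      min 1 (dist x z + (psi .last).eval M (Fin.snoc (α := fun _ => M) a z)) := fun z => by
    rw [eval_add, eval_dist, eval_lift, eval_last]
  have hle : ∀ z : M, z ≤ x → IsAtom z ∨ z = ⊥ →
      ((Formula.inf (.add (.dist t.lift .last) (psi .last))).eval M a : ℝ) ≤ m x - m z := by
    intro z hz hz'
    refine (coe_eval_inf_le a _ z).trans ?_
    rw [hbody, eval_psi_of_isAtom_or_bot _ _ (by rwa [eval_last]), add_zero, dist_eq_m_add_m,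
      sdiff_eq_bot_iff.2 hz, m_bot, add_zero, m_sdiff hz]
    exact min_le_right _ _
  refine le_antisymm ?_ (le_coe_eval_inf a _ fun z => ?_)
  · rw [le_sub_comm]
    refine topMass_one_le ?_ fun b hb hbx => ?_
    · simpa [m_bot] using hle ⊥ bot_le (Or.inr rfl)
    · rw [le_sub_comm]
      exact hle b hbx (Or.inl hb)
  · have h1 := le_eval_psi (Fin.snoc (α := fun _ => M) a z) .last
    rw [eval_last] at h1
    rw [hbody, dist_eq_m_add_m]
    refine le_min ((sub_le_self _ (topMass_nonneg _ _)).trans (m_le_one x)) ?_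
    have h2 := topMass_one_le_add x z
    have h3 := m_inf_add_sdiff x z
    have h4 := m_mono (inf_le_right : x ⊓ z ≤ z)
    linarith

/-- The measures of x ⊓ w and x ⊓ wᶜ add up to m x, so the infimum over w becomes the supremum in
the recursion for `topMass`. The shift k + 1 arises because `phi k` is φₖ₊₁. -/
lemma eval_phi (k : ℕ) (t : Term n) :
    ((phi k t).eval M a : ℝ) = m (t.eval M a) - topMass (k + 1) (t.eval M a) := by
  induction k generalizing n with
  | zero => exact eval_phi_zero a t
  | succ k ih =>
    have hphi : phi (k + 1) t = .inf (.add (phi k (.inter t.lift .last))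
      (phi 0 (.inter t.lift (.compl .last)))) := by
      conv_lhs => rw [phi]
    rw [hphi]
    set x := t.eval M a with hx
    have hbody : ∀ w : M, ((Formula.add (phi k (.inter t.lift .last))
        (phi 0 (.inter t.lift (.compl .last)))).eval M (Fin.snoc (α := fun _ => M) a w) : ℝ) =
        min 1 (m x - (topMass (k + 1) (x ⊓ w) + topMass 1 (x ⊓ wᶜ))) := fun w => by
      rw [eval_add, ih, eval_phi_zero, eval_inter, eval_inter, eval_compl, eval_lift, eval_last,
        ← m_inf_add_inf_compl x w]
      congr 1
      ring
    refine le_antisymm ?_ (le_coe_eval_inf a _ fun w => ?_)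
    · rw [le_sub_comm]
      refine topMass_le fun s hs => ?_
      obtain ⟨w, hw⟩ := exists_sum_le_topMass_add hs
      rw [le_sub_comm]
      refine (coe_eval_inf_le a _ w).trans ?_
      rw [hbody]
      exact (min_le_right _ _).trans (sub_le_sub_left hw _)
    · rw [hbody]
      exact le_min ((sub_le_self _ (topMass_nonneg _ _)).trans (m_le_one x))
        (sub_le_sub_left (topMass_add_le _ _ _) _)

end

/-! The sequence `Φ`. -/

section

variable {M : Type u} [LprStructure M] [hM : Fact (Models M Pr)]

lemma Phi_eq (k : ℕ) : Phi M k = sSup {r : unitInterval | ∃ s : Finset M, s.card = k + 1 ∧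
    ∀ x ∈ s, IsAtom x ∧ (r : ℝ) ≤ m x} := by
  simp only [Phi, atomSize, isContained_iff, isAtomEvent_iff, one_eq_top, le_top, true_and]
  rfl

lemma lt_Phi_iff {r : ℝ} (hr : 0 ≤ r) (k : ℕ) : r < Phi M k ↔
    ∃ s : Finset M, s.card = k + 1 ∧ ∀ x ∈ s, IsAtom x ∧ r < m x := by
  rw [Phi_eq]
  constructor
  · intro h
    have h1 : r ≤ 1 := h.le.trans (unitInterval.le_one _)
    obtain ⟨q, ⟨s, hs, hsq⟩, hq⟩ := lt_sSup_iff.1 (show (⟨r, hr, h1⟩ : unitInterval) < _ from h)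
    exact ⟨s, hs, fun x hx => ⟨(hsq x hx).1, lt_of_lt_of_le hq (hsq x hx).2⟩⟩
  · rintro ⟨s, hs, hsr⟩
    have hne : s.Nonempty := Finset.card_pos.1 (by omega)
    -- The least measure in s is an admissible value in the supremum and still exceeds r.
    obtain ⟨y, hy, hmin⟩ := s.exists_min_image (fun x => m x) hne
    refine lt_of_lt_of_le (hsr y hy).2 ?_
    exact le_sSup (a := (LprStructure.mu y : unitInterval))
      ⟨s, hs, fun x hx => ⟨(hsr x hx).1, hmin x hx⟩⟩

lemma finite_setOf_lt_m {A : Type*} [ProbabilityAlgebra A] {r : ℝ} (hr : 0 < r) :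
    {a : Atoms A | r < m a.1}.Finite :=
  Set.Finite.of_finite_image ((finite_atoms_lt hr).subset (by
    rintro _ ⟨a, ha, rfl⟩; exact ⟨a.2, ha⟩)) Subtype.val_injective.injOn

lemma lt_Phi_iff_lt_ncard {r : ℝ} (hr : 0 < r) (k : ℕ) :
    r < Phi M k ↔ k < {a : Atoms M | r < m a.1}.ncard := by
  have hfin : {a : Atoms M | r < m a.1}.Finite := finite_setOf_lt_m hr
  classical
  rw [lt_Phi_iff hr.le]
  constructor
  · rintro ⟨s, hs, hsr⟩
    have : (s.subtype IsAtom).card ≤ {a : Atoms M | r < m a.1}.ncard := by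
      rw [← Set.ncard_coe_finset]
      exact Set.ncard_le_ncard (fun a ha => (hsr a (Finset.mem_subtype.1 ha)).2) hfin
    rw [Finset.card_subtype, Finset.filter_true_of_mem fun a ha => (hsr a ha).1] at this
    omega
  · intro h
    obtain ⟨t, ht, hcard⟩ := Set.exists_subset_card_eq (Nat.succ_le_of_lt h)
    have htf : t.Finite := hfin.subset ht
    refine ⟨htf.toFinset.map (.subtype _), ?_, fun x hx => ?_⟩
    · rw [Finset.card_map, ← Set.ncard_eq_toFinset_card t htf, hcard]
    · obtain ⟨a, ha, rfl⟩ := Finset.mem_map.1 hx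
      exact ⟨a.2, ht (htf.mem_toFinset.1 ha)⟩

lemma topMass_succ_le (k : ℕ) : topMass (k + 1) (⊤ : M) ≤ topMass k (⊤ : M) + Phi M k := by
  classical
  refine topMass_le fun s hs => ?_
  rcases Nat.lt_or_ge k s.card with h | h
  -- The smallest of k + 1 atoms has measure at most `Phi M k`; the others are counted by `topMass
  -- k`.
  · obtain ⟨y, hy, hmin⟩ := s.exists_min_image (fun x => m x) (Finset.card_pos.1 (by omega))
    rw [← Finset.sum_erase_add _ _ hy]
    refine add_le_add (sum_le_topMass ⟨?_, fun a ha => hs.2 a (Finset.mem_of_mem_erase ha)⟩) ?_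
    · rw [Finset.card_erase_of_mem hy]
      exact Nat.sub_le_of_le_add hs.1
    · rw [Phi_eq]
      exact le_sSup (a := (LprStructure.mu y : unitInterval))
        ⟨s, le_antisymm hs.1 h, fun x hx => ⟨(hs.2 x hx).1, hmin x hx⟩⟩
  · exact (sum_le_topMass ⟨h, hs.2⟩).trans (le_add_of_nonneg_right (Phi M k).2.1)

lemma le_topMass_succ (k : ℕ) : topMass k (⊤ : M) + Phi M k ≤ topMass (k + 1) (⊤ : M) := by
  classical
  rw [← le_sub_iff_add_le]
  refine topMass_le fun s hs => ?_
  rw [le_sub_comm]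
  refine le_of_forall_lt fun r hr => ?_
  rw [lt_sub_iff_add_lt]
  rcases lt_or_ge r 0 with h0 | h0
  · exact (add_lt_of_neg_left _ h0).trans_le
      (sum_le_topMass ⟨hs.1.trans (Nat.le_succ k), hs.2⟩)
  · obtain ⟨t, ht, htr⟩ := (lt_Phi_iff h0 k).1 hr
    -- Among k + 1 atoms of measure above r, one is not in s and can be added to it.
    obtain ⟨b, hb, hbs⟩ := Finset.exists_mem_notMem_of_card_lt_card (s := s) (t := t)
      (by rw [ht]; exact Nat.lt_succ_of_le hs.1)
    refine (add_lt_add_left (htr b hb).2 _).trans_le ?_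
    rw [← Finset.sum_insert (f := fun x => m x) hbs]
    refine sum_le_topMass ⟨(Finset.card_insert_le _ _).trans (Nat.succ_le_succ hs.1), ?_⟩
    intro x hx
    rcases Finset.mem_insert.1 hx with rfl | hx
    · exact ⟨(htr x hb).1, le_top⟩
    · exact hs.2 x hx

lemma topMass_succ (k : ℕ) : topMass (k + 1) (⊤ : M) = topMass k (⊤ : M) + Phi M k :=
  (topMass_succ_le k).antisymm (le_topMass_succ k)

variable (M)

lemma eval_phi_one (k : ℕ) (a : Fin 0 → M) :
    ((phi k .one).eval M a : ℝ) = 1 - topMass (k + 1) (⊤ : M) := by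
  rw [eval_phi, ← m_top (A := M)]
  rfl

lemma eval_phi_zero_one (a : Fin 0 → M) :
    (phi 0 .one).eval M a = unitInterval.symm (Phi M 0) := by
  rw [Subtype.ext_iff, eval_phi_one, topMass_succ, topMass_zero, zero_add]
  rfl

lemma eval_phi_sub_phi (k : ℕ) (a : Fin 0 → M) :
    (Formula.sub (phi k .one) (phi (k + 1) .one)).eval M a = Phi M (k + 1) := by
  rw [Subtype.ext_iff, eval_sub, eval_phi_one, eval_phi_one, topMass_succ (k + 1),
    max_eq_right]
  · ring
  · have := (Phi M (k + 1)).2.1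
    linarith

lemma models_atomSizeAxioms_iff (t : ℕ → unitInterval) :
    Models M (atomSizeAxioms t) ↔ Phi M = t := by
  simp only [Models, atomSizeAxioms, Set.forall_mem_insert, Set.forall_mem_range, Sentence.value,
    eval_eqConst_eq_zero, eval_phi_zero_one, eval_phi_sub_phi, funext_iff,
    unitInterval.symm_inj]
  exact ⟨fun h k => by cases k with
    | zero => exact h.1
    | succ k => exact h.2 k, fun h => ⟨h 0, fun k => h (k + 1)⟩⟩

end

end ProbAlg

/-! ### Back-and-forth between models with the same atom sizes. -/

namespace ProbAlg

open ProbabilityAlgebra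

namespace ProbabilityAlgebra

/-- Splitting every piece `p i` of a partition into `c i` and `p i \ c i`. -/
lemma IsPartition.split {A : Type*} [ProbabilityAlgebra A]
    {k : ℕ} {p : Fin k → A} (hp : IsPartition p) {c : Fin k → A} (hc : ∀ i, c i ≤ p i) :
    IsPartition (Fin.append c fun i => p i \ c i) := by
  have hle : ∀ i, p i \ c i ≤ p i := fun i => sdiff_le
  have hd : ∀ i j, Disjoint (c i) (p j \ c j) := fun i j => by
    rcases eq_or_ne i j with rfl | h
    · exact disjoint_sdiff_self_right
    · exact (hp.1 h).mono (hc i) (hle j)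
  refine ⟨fun i j => ?_, top_le_iff.1 ?_⟩
  · refine Fin.addCases (fun i => ?_) (fun i => ?_) i <;>
      refine Fin.addCases (fun j => ?_) (fun j => ?_) j <;> intro hij <;>
      simp only [Fin.append_left, Fin.append_right]
    · exact (hp.1 fun h => hij (congrArg _ h)).mono (hc i) (hc j)
    · exact hd i j
    · exact (hd j i).symm
    · exact (hp.1 fun h => hij (congrArg _ h)).mono (hle i) (hle j)
  · rw [← hp.2]
    refine Finset.sup_le fun i _ => ?_
    rw [← sup_sdiff_cancel_right (hc i)]
    refine sup_le ?_ ?_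
    · have := Finset.le_sup (f := Fin.append c fun i => p i \ c i)
        (Finset.mem_univ (Fin.castAdd k i))
      rwa [Fin.append_left] at this
    · have := Finset.le_sup (f := Fin.append c fun i => p i \ c i)
        (Finset.mem_univ (Fin.natAdd k i))
      rwa [Fin.append_right] at this

/-- A union of old pieces is re-indexed by both halves of each, so earlier entries of a tuple
survive a refinement. -/
lemma sup_append_sdiff {A : Type*} [ProbabilityAlgebra A]
    {k : ℕ} {p c : Fin k → A} (hc : ∀ i, c i ≤ p i) (S : Finset (Fin k)) :
    ((S.map (Fin.castAddEmb k)) ∪ (S.map (Fin.natAddEmb k))).sup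
      (Fin.append c fun i => p i \ c i) = S.sup p := by
  rw [Finset.sup_union, Finset.sup_map, Finset.sup_map, ← Finset.sup_sup]
  refine Finset.sup_congr rfl fun i _ => ?_
  simp only [Pi.sup_apply, Function.comp_apply, Fin.castAddEmb_apply, Fin.natAddEmb_apply,
    Fin.append_left, Fin.append_right, sup_sdiff_cancel_right (hc i)]

end ProbabilityAlgebra

section BackAndForth

variable {M : Type u} {N : Type v} [LprStructure M] [LprStructure N] [hM : Fact (Models M Pr)]
  [hN : Fact (Models N Pr)]

/-- The tuples `a` and `b` are given by the same unions of pieces of matched partitions. -/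
def BackForth (π : Atoms M ≃ Atoms N) {n : ℕ} (a : Fin n → M) (b : Fin n → N) : Prop :=
  ∃ (k : ℕ) (p : Fin k → M) (q : Fin k → N) (S : Fin n → Finset (Fin k)),
    IsPartition p ∧ IsPartition q ∧ (∀ i, Matched π (p i) (q i)) ∧
      (∀ i, a i = (S i).sup p) ∧ ∀ i, b i = (S i).sup q

namespace BackForth

variable {π : Atoms M ≃ Atoms N} {n : ℕ} {a : Fin n → M} {b : Fin n → N}

lemma symm (h : BackForth π a b) : BackForth π.symm b a := by
  obtain ⟨k, p, q, S, hp, hq, hpq, ha, hb⟩ := h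
  exact ⟨k, q, p, S, hq, hp, fun i => (hpq i).symm, hb, ha⟩

lemma empty (π : Atoms M ≃ Atoms N) (a : Fin 0 → M) (b : Fin 0 → N) : BackForth π a b :=
  ⟨1, fun _ => ⊤, fun _ => ⊤, fun i => i.elim0,
    ⟨fun i j h => absurd (Subsingleton.elim i j) h, by simp⟩,
    ⟨fun i j h => absurd (Subsingleton.elim i j) h, by simp⟩,
    fun _ => Matched.top, fun i => i.elim0, fun i => i.elim0⟩

lemma exists_term_eval (h : BackForth π a b) : ∃ (k : ℕ) (p : Fin k → M) (q : Fin k → N),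
    IsPartition p ∧ IsPartition q ∧ (∀ i, Matched π (p i) (q i)) ∧
      ∀ t : Term n, ∃ S : Finset (Fin k), t.eval M a = S.sup p ∧ t.eval N b = S.sup q := by
  obtain ⟨k, p, q, S, hp, hq, hpq, ha, hb⟩ := h
  refine ⟨k, p, q, hp, hq, hpq, fun t => ?_⟩
  induction t with
  | var i => exact ⟨S i, ha i, hb i⟩
  | zero => exact ⟨∅, rfl, rfl⟩
  | one => exact ⟨Finset.univ, hp.2.symm, hq.2.symm⟩
  | compl t ih =>
    obtain ⟨S, h1, h2⟩ := ih
    exact ⟨Sᶜ, (congrArg _ h1).trans (hp.sup_compl S).symm,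
      (congrArg _ h2).trans (hq.sup_compl S).symm⟩
  | inter s t ihs iht =>
    obtain ⟨S, h1, h2⟩ := ihs
    obtain ⟨T, h3, h4⟩ := iht
    exact ⟨S ∩ T, (congrArg₂ _ h1 h3).trans (hp.sup_inter S T).symm,
      (congrArg₂ _ h2 h4).trans (hq.sup_inter S T).symm⟩
  | union s t ihs iht =>
    obtain ⟨S, h1, h2⟩ := ihs
    obtain ⟨T, h3, h4⟩ := iht
    exact ⟨S ∪ T, (congrArg₂ _ h1 h3).trans Finset.sup_union.symm,
      (congrArg₂ _ h2 h4).trans Finset.sup_union.symm⟩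

lemma mu_eval_eq (h : BackForth π a b) (t : Term n) :
    LprStructure.mu (t.eval M a) = LprStructure.mu (t.eval N b) := by
  obtain ⟨k, p, q, hp, hq, hpq, ht⟩ := h.exists_term_eval
  obtain ⟨S, h1, h2⟩ := ht t
  rw [Subtype.ext_iff, h1, h2]
  exact (Matched.finset_sup hpq hp.1 hq.1 S).1

/-- Every piece p i is cut by x, and `Matched.exists_le` finds a matching cut d i of q i. The join
of the d i answers x. -/
lemma forth (hπ : ∀ x, m (π x).1 = m x.1) (h : BackForth π a b) (x : M) :
    ∃ y : N, BackForth π (Fin.snoc (α := fun _ => M) a x) (Fin.snoc (α := fun _ => N) b y) := by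
  obtain ⟨k, p, q, S, hp, hq, hpq, ha, hb⟩ := h
  have hc : ∀ i, p i ⊓ x ≤ p i := fun i => inf_le_left
  choose d hd hcd using fun i => (hpq i).exists_le hπ (hc i)
  refine ⟨Finset.univ.sup d, k + k, Fin.append (fun i => p i ⊓ x) fun i => p i \ (p i ⊓ x),
    Fin.append d fun i => q i \ d i, Fin.snoc
      (fun i => ((S i).map (Fin.castAddEmb k)) ∪ ((S i).map (Fin.natAddEmb k)))
      (Finset.univ.map (Fin.castAddEmb k)), hp.split hc, hq.split hd, ?_, ?_, ?_⟩
  · refine Fin.addCases (fun i => ?_) (fun i => ?_)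
    · simpa only [Fin.append_left] using hcd i
    · simpa only [Fin.append_right] using (hpq i).sdiff (hcd i) (hc i) (hd i)
  · refine Fin.lastCases ?_ fun i => ?_
    · rw [Fin.snoc_last, Fin.snoc_last, Finset.sup_map]
      simp only [Function.comp_def, Fin.castAddEmb_apply, Fin.append_left]
      rw [← Finset.sup_inf_distrib_right, hp.2, top_inf_eq]
    · rw [Fin.snoc_castSucc, Fin.snoc_castSucc, sup_append_sdiff hc, ha]
  · refine Fin.lastCases ?_ fun i => ?_
    · rw [Fin.snoc_last, Fin.snoc_last, Finset.sup_map]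
      simp only [Function.comp_def, Fin.castAddEmb_apply, Fin.append_left]
    · rw [Fin.snoc_castSucc, Fin.snoc_castSucc, sup_append_sdiff hd, hb]

lemma back (hπ : ∀ x, m (π x).1 = m x.1) (h : BackForth π a b) (y : N) :
    ∃ x : M, BackForth π (Fin.snoc (α := fun _ => M) a x) (Fin.snoc (α := fun _ => N) b y) := by
  obtain ⟨x, hx⟩ := h.symm.forth (fun z => by rw [← hπ, π.apply_symm_apply]) y
  exact ⟨x, hx.symm⟩

/-- Each witness on one side has an exact counterpart on the other, so the suprema and infima agree
without any ε. -/
lemma eval_eq (hπ : ∀ x, m (π x).1 = m x.1) (h : BackForth π a b) (φ : Formula n) :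
    φ.eval M a = φ.eval N b := by
  induction φ with
  | mu t => exact h.mu_eval_eq t
  | dist s t =>
    rw [Subtype.ext_iff, eval_dist, eval_dist, dist_eq_mu_symmDiff, dist_eq_mu_symmDiff,
      symmDiff, symmDiff, sdiff_eq, sdiff_eq, sdiff_eq, sdiff_eq]
    exact congrArg Subtype.val (h.mu_eval_eq (.union (.inter s (.compl t)) (.inter t (.compl s))))
  | conn c φ ih => exact congrArg c (funext fun i => ih i h)
  | sup φ ih =>
    refine le_antisymm (iSup_le fun x => ?_) (iSup_le fun y => ?_)
    · obtain ⟨y, hy⟩ := h.forth hπ x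
      rw [ih hy]
      exact le_iSup (fun y : N => φ.eval N (Fin.snoc (α := fun _ => N) b y)) y
    · obtain ⟨x, hx⟩ := h.back hπ y
      rw [← ih hx]
      exact le_iSup (fun x : M => φ.eval M (Fin.snoc (α := fun _ => M) a x)) x
  | inf φ ih =>
    refine le_antisymm (le_iInf fun y => ?_) (le_iInf fun x => ?_)
    · obtain ⟨x, hx⟩ := h.back hπ y
      rw [← ih hx]
      exact iInf_le (fun x : M => φ.eval M (Fin.snoc (α := fun _ => M) a x)) x
    · obtain ⟨y, hy⟩ := h.forth hπ x
      rw [ih hy]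
      exact iInf_le (fun y : N => φ.eval N (Fin.snoc (α := fun _ => N) b y)) y

end BackForth

lemma elemEquiv_of_Phi_eq (h : Phi M = Phi N) : ElemEquiv M N := by
  obtain ⟨π, hπ⟩ := exists_equiv_of_ncard_eq (fun a : Atoms M => m a.1) (fun b : Atoms N => m b.1)
    (fun a => m_pos _ a.2.1) (fun b => m_pos _ b.2.1) (fun r hr => finite_setOf_lt_m hr)
    -- The number of atoms above r exceeds k exactly when the term of index k exceeds r, so the
    -- sequence determines all these counts.
    (fun r hr => finite_setOf_lt_m hr) fun r hr => eq_of_forall_lt_iff fun k => by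
      rw [← lt_Phi_iff_lt_ncard hr, ← lt_Phi_iff_lt_ncard hr, h]
  exact fun σ => (BackForth.empty π _ _).eval_eq hπ σ

lemma Phi_eq_of_elemEquiv (h : ElemEquiv M N) : Phi M = Phi N := by
  funext k
  cases k with
  | zero =>
    rw [← unitInterval.symm_inj, ← eval_phi_zero_one M Fin.elim0, ← eval_phi_zero_one N Fin.elim0]
    exact h _
  | succ k =>
    rw [← eval_phi_sub_phi M k Fin.elim0, ← eval_phi_sub_phi N k Fin.elim0]
    exact h _

end BackAndForth

lemma models_union_iff (M : Type u) [LprStructure M] (S T : Theory) :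
    Models M (S ∪ T) ↔ Models M S ∧ Models M T :=
  ⟨fun h => ⟨fun σ hσ => h σ (Or.inl hσ), fun σ hσ => h σ (Or.inr hσ)⟩,
    fun h σ hσ => hσ.elim (h.1 σ) (h.2 σ)⟩

end ProbAlg

theorem corollary4p12 :
    (∀ (M : Type u) (N : Type v) [ProbAlg.LprStructure M] [ProbAlg.LprStructure N],
      ProbAlg.Models M ProbAlg.Pr → ProbAlg.Models N ProbAlg.Pr →
        (ProbAlg.ElemEquiv M N ↔ ProbAlg.Phi M = ProbAlg.Phi N)) ∧
    (∀ T : ProbAlg.Theory, ProbAlg.Theory.IsComplete.{u} T →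
      ProbAlg.Theory.Extends.{u} T ProbAlg.Pr →
      ∃ t : ℕ → unitInterval,
        (∀ (M : Type u) [ProbAlg.LprStructure M], ProbAlg.Models M T → ProbAlg.Phi M = t) ∧
        ProbAlg.Theory.IsAxiomatizedBy.{u} T (ProbAlg.Pr ∪ ProbAlg.atomSizeAxioms t)) := by
  refine ⟨fun M N _ _ hM hN => ?_, fun T ⟨⟨M₀, _, hM₀⟩, hT⟩ hext => ?_⟩
  · have := Fact.mk hM
    have := Fact.mk hN
    exact ⟨ProbAlg.Phi_eq_of_elemEquiv, ProbAlg.elemEquiv_of_Phi_eq⟩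
  · have := Fact.mk (hext M₀ hM₀)
    have hPhi : ∀ (M : Type u) [ProbAlg.LprStructure M], ProbAlg.Models M T →
        ProbAlg.Phi M = ProbAlg.Phi M₀ := by
      intro M _ hM
      have := Fact.mk (hext M hM)
      exact ProbAlg.Phi_eq_of_elemEquiv (hT M M₀ hM hM₀)
    refine ⟨ProbAlg.Phi M₀, hPhi, fun M _ => ?_⟩
    rw [ProbAlg.models_union_iff]
    refine ⟨fun hM => ?_, fun ⟨hPr, hM⟩ σ hσ => ?_⟩
    · have := Fact.mk (hext M hM)
      exact ⟨this.out, (ProbAlg.models_atomSizeAxioms_iff M _).2 (hPhi M hM)⟩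
    -- The axioms force the sequence of M₀, so M is elementarily equivalent to M₀ and inherits the
    -- conditions of T.
    · have := Fact.mk hPr
      rw [ProbAlg.elemEquiv_of_Phi_eq ((ProbAlg.models_atomSizeAxioms_iff M _).1 hM) σ]
      exact hM₀ σ hσ
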